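/- Let $p_1,p_2,p_3$ be the vertices of an equilateral triangle in $\mathbb R^2$, let $\varphi_i(x)=x/2+p_i/2$, and let $K\subset\mathbb R^2$ be the Sierpinski gasket, the nonempty compact set with $K=\bigcup_{i=1}^3\varphi_i(K)$. Let $x\sim_n y$ be the adjacency relation of the $n$-th approximating graph, whose edges are the pairs $\{\varphi_w(p_i),\varphi_w(p_j)\}$, $i\neq j$, with $w$ a word of length $n$ and $\varphi_w=\varphi_{w_1}\circ\dots\circ\varphi_{w_n}$. For real $u,v\in C(K)$ put $$\mathcal E_n(u,v)=\Big(\frac53\Big)^n\sum_{\{x,y\}:\,x\sim_n y}(u(x)-u(y))(v(x)-v(y)),\qquad \mathcal E(u,v)=\lim_n\mathcal E_n(u,v),$$ the latter on $\mathcal F=\{u\in C(K):\sup_n\mathcal E_n(u,u)<\infty\}$. For $f\in\mathcal F$ let $\nu_f$ be its energy measure, i.e. the finite Borel measure on $K$ with $$\int_K g\,d\nu_f=\lim_n\Big(\frac53\Big)^n\sum_{\{x,y\}:\,x\sim_n y}\frac{g(x)+g(y)}2\,(f(x)-f(y))^2,\qquad g\in C(K),$$ and let $\nu_{f,g}=\frac14(\nu_{f+g}-\nu_{f-g})$.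 Let $h_1,h_2$ be a complete energy orthonormal system for the space of nonconstant harmonic functions (with respect to the boundary $\{p_1,p_2,p_3\}$), let $\nu=\nu_{h_1}+\nu_{h_2}$ be the Kusuoka measure, and let $\Gamma(f,g)=d\nu_{f,g}/d\nu$. Let $\mathcal F_{\mathbb C}=\mathcal F+i\mathcal F$, extend $\mathcal E$ and $\Gamma$ sesquilinearly (linear in the first argument) to $\mathcal F_{\mathbb C}$, and identify $f \in \mathcal F_{\mathbb C}$ with its class in $L_{2,\mathbb C}(K,\nu)$. Let $\mathcal H_{\mathbb C}$ be the Hilbert space obtained from $\mathcal F_{\mathbb C}\otimes\mathcal F_{\mathbb C}$ with $$\langle a\otimes b,c\otimes d\rangle_{\mathcal H}=\int_K b\,\overline d\,\Gamma(a,c)\,d\nu$$ by factoring out trivial elements and completing, and let $\partial f=f\otimes\mathbf 1\in\mathcal H_{\mathbb C}$ for $f\in\mathcal F_{\mathbb C}$. Let $\partial^\ast$ be the unbounded operator from $\mathcal H_{\mathbb C}$ to $L_{2,\mathbb C}(K,\nu)$ such that $v\in\operatorname{dom}\partial^\ast$ and $\partial^\ast v=v^\ast$ if and only if $v^\ast\in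 L_{2,\mathbb C}(K,\nu)$ satisfies $\langle v^\ast,u\rangle_{L_2(K,\nu)}=-\langle v,\partial u\rangle_{\mathcal H}$ for all $u\in\mathcal F_{\mathbb C}$. Let $\Delta_\nu$ be the operator in $L_{2,\mathbb C}(K,\nu)$ associated with $(\mathcal E,\mathcal F_{\mathbb C})$: $g\in\operatorname{dom}\Delta_\nu$ and $\Delta_\nu g=w$ if and only if $g\in\mathcal F_{\mathbb C}$, $w\in L_{2,\mathbb C}(K,\nu)$ and $\mathcal E(f,g)=-\langle f,w\rangle_{L_2(K,\nu)}$ for all $f\in\mathcal F_{\mathbb C}$. Then $$\operatorname{dom}\partial^\ast=\{v\in\mathcal H_{\mathbb C}:\ v=\partial f+w,\ f\in\operatorname{dom}\Delta_\nu,\ w\in\ker\partial^\ast\}.$$ For any $v=\partial f+w$ with $f\in\operatorname{dom}\Delta_\nu$ and $w\in\ker\partial^\ast$ we have $\partial^\ast v=\Delta_\nu f$, and for any $g\in\operatorname{dom}\Delta_\nu$ we have $\partial g\in\operatorname{dom}\partial^\ast$ and $\Delta_\nu g=\partial^\ast\partial g$ in $L_{2,\mathbb C}(K,\nu)$. -/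

import Mathlib

open Filter Topology MeasureTheory
open scoped TensorProduct ComplexConjugate

noncomputable section

/-- The Sierpinski gasket: `p` are the vertices of an equilateral triangle in the Euclidean plane
and `K` is the nonempty compact set with `K = ⋃ i, φ i '' K`, where `φ i x = x / 2 + p i / 2`. -/
structure SierpinskiGasket where
  p : Fin 3 → EuclideanSpace ℝ (Fin 2)
  side : ℝ
  side_pos : 0 < side
  equilateral : ∀ i j, i ≠ j → dist (p i) (p j) = side
  K : Set (EuclideanSpace ℝ (Fin 2))
  nonempty : K.Nonempty
  isCompact : IsCompact K
  selfSimilar : K = ⋃ i, (fun x => (2⁻¹ : ℝ) • x + (2⁻¹ : ℝ) • p i) '' K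

namespace SierpinskiGasket

variable (S : SierpinskiGasket)

instance : CompactSpace S.K := isCompact_iff_compactSpace.mp S.isCompact

theorem phi_mem (i : Fin 3) {x : EuclideanSpace ℝ (Fin 2)} (hx : x ∈ S.K) :
    (2⁻¹ : ℝ) • x + (2⁻¹ : ℝ) • S.p i ∈ S.K := by
  rw [S.selfSimilar]
  exact Set.mem_iUnion.mpr ⟨i, x, hx, rfl⟩

/-- The contraction `φ i`, as a map of the gasket into itself. -/
def phi (i : Fin 3) : C(S.K, S.K) where
  toFun x := ⟨(2⁻¹ : ℝ) • (x : EuclideanSpace ℝ (Fin 2)) + (2⁻¹ : ℝ) • S.p i, S.phi_mem i x.2⟩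
  continuous_toFun := by fun_prop

theorem dist_phi (i : Fin 3) (x y : S.K) : dist (S.phi i x) (S.phi i y) = 2⁻¹ * dist x y := by
  rw [Subtype.dist_eq, Subtype.dist_eq]
  simp only [phi, ContinuousMap.coe_mk, dist_add_right, dist_smul₀]
  norm_num

theorem p_mem (i : Fin 3) : S.p i ∈ S.K := by
  obtain ⟨x₀, hx₀⟩ := S.nonempty
  have key : ∀ n : ℕ, S.p i + (2⁻¹ : ℝ) ^ n • (x₀ - S.p i) ∈ S.K := by
    intro n
    induction n with
    | zero => simpa using hx₀
    | succ n ih =>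
      convert S.phi_mem i ih using 1
      rw [pow_succ]
      module
  have hlim : Tendsto (fun n : ℕ => S.p i + (2⁻¹ : ℝ) ^ n • (x₀ - S.p i)) atTop (𝓝 (S.p i)) := by
    have h := (tendsto_pow_atTop_nhds_zero_of_lt_one (r := (2⁻¹ : ℝ)) (by norm_num)
      (by norm_num)).smul_const (x₀ - S.p i)
    simpa using h.const_add (S.p i)
  exact S.isCompact.isClosed.mem_of_tendsto hlim (Eventually.of_forall key)

/-- The vertices of the triangle, as points of the gasket. -/
def vertex (i : Fin 3) : S.K := ⟨S.p i, S.p_mem i⟩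

theorem phi_vertex_comm (i j : Fin 3) : S.phi i (S.vertex j) = S.phi j (S.vertex i) := by
  apply Subtype.ext
  simp only [phi, vertex, ContinuousMap.coe_mk]
  rw [add_comm]

theorem phi_vertex_self (i : Fin 3) : S.phi i (S.vertex i) = S.vertex i := by
  apply Subtype.ext
  simp only [phi, vertex, ContinuousMap.coe_mk]
  module

/-- `φ_w = φ (w 0) ∘ ⋯ ∘ φ (w (n - 1))` for a word `w` of length `n`. -/
def wordMap : (n : ℕ) → (Fin n → Fin 3) → C(S.K, S.K)
  | 0, _ => ContinuousMap.id S.K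
  | n + 1, w => (S.phi (w 0)).comp (wordMap n (Fin.tail w))

theorem sum_word_succ {M : Type*} [AddCommMonoid M] (n : ℕ) (a : (Fin (n + 1) → Fin 3) → M) :
    ∑ w, a w = ∑ i, ∑ w : Fin n → Fin 3, a (Fin.cons i w) := by
  rw [← (Fin.consEquiv (fun _ : Fin (n + 1) => Fin 3)).sum_comp, Fintype.sum_prod_type]
  rfl

/-- The discrete energy `E_n(u, v) = (5/3)^n ∑_{x ∼_n y} (u x - u y) (v x - v y)`. The edges of
the `n`-th approximating graph are the pairs `{φ_w (p i), φ_w (p (i + 1))}` with `w` a word of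
length `n` and `i` modulo `3`, every edge being listed once. -/
def discreteEnergy (n : ℕ) (u v : C(S.K, ℝ)) : ℝ :=
  (5 / 3) ^ n * ∑ w : Fin n → Fin 3, ∑ i : Fin 3,
    (u (S.wordMap n w (S.vertex i)) - u (S.wordMap n w (S.vertex (i + 1)))) *
      (v (S.wordMap n w (S.vertex i)) - v (S.wordMap n w (S.vertex (i + 1))))

/-- The integral of `g` against the discrete energy measure of `f`, in which the contribution
`(5/3)^n (f x - f y)^2` of an edge `x ∼_n y` is shared equally by its two endpoints. -/
def discreteEnergyIntegral (n : ℕ) (f g : C(S.K, ℝ)) : ℝ :=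
  (5 / 3) ^ n * ∑ w : Fin n → Fin 3, ∑ i : Fin 3,
    (g (S.wordMap n w (S.vertex i)) + g (S.wordMap n w (S.vertex (i + 1)))) / 2 *
      (f (S.wordMap n w (S.vertex i)) - f (S.wordMap n w (S.vertex (i + 1)))) ^ 2

theorem discreteEnergy_self_nonneg (n : ℕ) (u : C(S.K, ℝ)) : 0 ≤ S.discreteEnergy n u u :=
  mul_nonneg (by positivity)
    (Finset.sum_nonneg fun _ _ => Finset.sum_nonneg fun _ _ => mul_self_nonneg _)

theorem discreteEnergyIntegral_one (n : ℕ) (f : C(S.K, ℝ)) :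
    S.discreteEnergyIntegral n f 1 = S.discreteEnergy n f f := by
  simp only [discreteEnergyIntegral, discreteEnergy, ContinuousMap.one_apply]
  congr 1
  refine Finset.sum_congr rfl fun _ _ => Finset.sum_congr rfl fun _ _ => ?_
  ring

theorem discreteEnergyIntegral_succ (n : ℕ) (f g : C(S.K, ℝ)) :
    S.discreteEnergyIntegral (n + 1) f g =
      5 / 3 * ∑ i, S.discreteEnergyIntegral n (f.comp (S.phi i)) (g.comp (S.phi i)) := by
  simp only [discreteEnergyIntegral, sum_word_succ, wordMap, Fin.cons_zero, Fin.tail_cons,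
    ContinuousMap.comp_apply, ← Finset.mul_sum]
  ring

theorem discreteEnergy_self_succ (n : ℕ) (f : C(S.K, ℝ)) :
    S.discreteEnergy (n + 1) f f =
      5 / 3 * ∑ i, S.discreteEnergy n (f.comp (S.phi i)) (f.comp (S.phi i)) := by
  simp only [← discreteEnergyIntegral_one]
  exact S.discreteEnergyIntegral_succ n f 1

theorem discreteEnergy_self_mono (f : C(S.K, ℝ)) : Monotone fun n => S.discreteEnergy n f f := by
  refine monotone_nat_of_le_succ fun n => ?_
  induction n generalizing f with
  | zero =>
    have h01 := S.phi_vertex_comm 0 1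
    have h12 := S.phi_vertex_comm 1 2
    have h20 := S.phi_vertex_comm 2 0
    rw [discreteEnergy_self_succ]
    simp only [discreteEnergy, wordMap, pow_zero, one_mul, Finset.univ_unique, Finset.sum_singleton,
      ContinuousMap.id_apply, ContinuousMap.comp_apply, Fin.sum_univ_three, Fin.isValue,
      show (0 : Fin 3) + 1 = 1 from rfl, show (1 : Fin 3) + 1 = 2 from rfl,
      show (2 : Fin 3) + 1 = 0 from rfl, phi_vertex_self, h01, h12, h20]
    generalize f (S.vertex 0) = a
    generalize f (S.vertex 1) = b
    generalize f (S.vertex 2) = c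
    generalize f (S.phi 1 (S.vertex 0)) = x
    generalize f (S.phi 2 (S.vertex 1)) = y
    generalize f (S.phi 0 (S.vertex 2)) = z
    nlinarith [sq_nonneg (5 * x - 2 * a - 2 * b - c), sq_nonneg (5 * y - a - 2 * b - 2 * c),
      sq_nonneg (5 * z - 2 * a - b - 2 * c), sq_nonneg (x + y + z - a - b - c),
      sq_nonneg (x - y - (a - c) / 5), sq_nonneg (y - z - (b - a) / 5),
      sq_nonneg (z - x - (c - b) / 5)]
  | succ n ih =>
    rw [discreteEnergy_self_succ, discreteEnergy_self_succ]
    gcongr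
    exact ih _

/-- The space `F` of continuous functions of finite energy, `sup_n E_n(u) < ∞`. -/
def F : Submodule ℝ C(S.K, ℝ) where
  carrier := {u | BddAbove (Set.range fun n => S.discreteEnergy n u u)}
  zero_mem' := by
    refine ⟨0, ?_⟩
    rintro _ ⟨n, rfl⟩
    simp [discreteEnergy]
  add_mem' := by
    rintro u v ⟨a, ha⟩ ⟨b, hb⟩
    refine ⟨2 * a + 2 * b, ?_⟩
    rintro _ ⟨n, rfl⟩
    have h1 : S.discreteEnergy n u u ≤ a := ha ⟨n, rfl⟩
    have h2 : S.discreteEnergy n v v ≤ b := hb ⟨n, rfl⟩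
    have h3 : S.discreteEnergy n (u + v) (u + v) + S.discreteEnergy n (u - v) (u - v) =
        2 * S.discreteEnergy n u u + 2 * S.discreteEnergy n v v := by
      simp only [discreteEnergy, ContinuousMap.add_apply, ContinuousMap.sub_apply, Finset.mul_sum,
        ← Finset.sum_add_distrib]
      refine Finset.sum_congr rfl fun _ _ => Finset.sum_congr rfl fun _ _ => ?_
      ring
    have h4 := S.discreteEnergy_self_nonneg n (u - v)
    simp only
    linarith
  smul_mem' := by
    rintro c u ⟨a, ha⟩
    refine ⟨c ^ 2 * a, ?_⟩
    rintro _ ⟨n, rfl⟩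
    have h1 : S.discreteEnergy n u u ≤ a := ha ⟨n, rfl⟩
    have h3 : S.discreteEnergy n (c • u) (c • u) = c ^ 2 * S.discreteEnergy n u u := by
      simp only [discreteEnergy, ContinuousMap.smul_apply, Finset.mul_sum, smul_eq_mul]
      refine Finset.sum_congr rfl fun _ _ => Finset.sum_congr rfl fun _ _ => ?_
      ring
    simp only [h3]
    gcongr

variable {S}

/-- The energy form `E(u, v) = lim_n E_n(u, v)`. -/
def energy (u v : S.F) : ℝ := limUnder atTop fun n => S.discreteEnergy n u v

theorem tendsto_energy (u v : S.F) :
    Tendsto (fun n => S.discreteEnergy n u v) atTop (𝓝 (energy u v)) := by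
  have key : ∀ f : S.F, ∃ a, Tendsto (fun n => S.discreteEnergy n f f) atTop (𝓝 a) := fun f =>
    ⟨_, tendsto_atTop_ciSup (S.discreteEnergy_self_mono f) f.2⟩
  obtain ⟨a, ha⟩ := key (u + v)
  obtain ⟨b, hb⟩ := key (u - v)
  refine tendsto_nhds_limUnder ⟨(a - b) / 4, ?_⟩
  convert (ha.sub hb).div_const 4 using 2 with n
  simp only [discreteEnergy, Submodule.coe_add, Submodule.coe_sub, ContinuousMap.add_apply,
    ContinuousMap.sub_apply, Finset.mul_sum, Finset.sum_div, ← Finset.sum_sub_distrib]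
  refine Finset.sum_congr rfl fun _ _ => Finset.sum_congr rfl fun _ _ => ?_
  ring

theorem discreteEnergy_le_energy (f : S.F) (n : ℕ) : S.discreteEnergy n f f ≤ energy f f :=
  (S.discreteEnergy_self_mono f).ge_of_tendsto (tendsto_energy f f) n

theorem abs_discreteEnergyIntegral_sub_le (n : ℕ) (f g : C(S.K, ℝ)) {c ω : ℝ}
    (hg : ∀ x, |g x - c| ≤ ω) :
    |S.discreteEnergyIntegral n f g - c * S.discreteEnergy n f f| ≤
      ω * S.discreteEnergy n f f := by
  rw [abs_le]
  simp only [abs_le] at hg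
  constructor
  · rw [neg_le_sub_iff_le_add, ← sub_le_iff_le_add', sub_le_comm, ← sub_mul]
    simp only [discreteEnergyIntegral, discreteEnergy, Finset.mul_sum]
    refine Finset.sum_le_sum fun w _ => Finset.sum_le_sum fun i _ => ?_
    have h1 := (hg (S.wordMap n w (S.vertex i))).1
    have h2 := (hg (S.wordMap n w (S.vertex (i + 1)))).1
    rw [mul_left_comm, ← pow_two]
    gcongr
    linarith
  · rw [sub_le_iff_le_add, ← add_mul]
    simp only [discreteEnergyIntegral, discreteEnergy, Finset.mul_sum]
    refine Finset.sum_le_sum fun w _ => Finset.sum_le_sum fun i _ => ?_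
    have h1 := (hg (S.wordMap n w (S.vertex i))).2
    have h2 := (hg (S.wordMap n w (S.vertex (i + 1)))).2
    rw [mul_left_comm (ω + c), ← pow_two]
    gcongr
    linarith

theorem abs_discreteEnergyIntegral_add_sub_le (n m : ℕ) (f g : C(S.K, ℝ)) {M ω : ℝ}
    (hM : ∀ x, |g x| ≤ M)
    (hω : ∀ (w : Fin n → Fin 3) x y, |g (S.wordMap n w x) - g (S.wordMap n w y)| ≤ ω) :
    |S.discreteEnergyIntegral (m + n) f g - S.discreteEnergyIntegral n f g| ≤
      2 * ω * S.discreteEnergy (m + n) f f +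
        M * (S.discreteEnergy (m + n) f f - S.discreteEnergy n f f) := by
  induction n generalizing f g with
  | zero =>
    have hc : ∀ x, |g x - g (S.vertex 0)| ≤ ω := fun x => hω ![] x (S.vertex 0)
    have hω0 : 0 ≤ ω := (abs_nonneg _).trans (hc (S.vertex 0))
    have h1 := abs_le.mp (abs_discreteEnergyIntegral_sub_le (m + 0) f g hc)
    have h2 := abs_le.mp (abs_discreteEnergyIntegral_sub_le 0 f g hc)
    have h3 : S.discreteEnergy 0 f f ≤ S.discreteEnergy (m + 0) f f :=
      S.discreteEnergy_self_mono f (Nat.zero_le _)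
    have h4 := abs_le.mp (hM (S.vertex 0))
    have h5 := mul_le_mul_of_nonneg_left h3 hω0
    have h6 := mul_le_mul_of_nonneg_right h4.2 (sub_nonneg.mpr h3)
    have h7 := mul_le_mul_of_nonneg_right h4.1 (sub_nonneg.mpr h3)
    rw [abs_le]
    constructor <;> nlinarith
  | succ n ih =>
    rw [← add_assoc, discreteEnergyIntegral_succ, discreteEnergyIntegral_succ,
      discreteEnergy_self_succ, discreteEnergy_self_succ]
    have key := fun i : Fin 3 => ih (f.comp (S.phi i)) (g.comp (S.phi i)) (fun x => hM _)
      (fun w x y => by simpa [wordMap, Fin.tail_cons] using hω (Fin.cons i w) x y)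
    rw [← mul_sub, abs_mul, abs_of_pos (by norm_num : (0 : ℝ) < 5 / 3),
      ← Finset.sum_sub_distrib]
    refine (mul_le_mul_of_nonneg_left ((Finset.abs_sum_le_sum_abs _ _).trans
      (Finset.sum_le_sum fun i _ => key i)) (by norm_num)).trans (le_of_eq ?_)
    simp only [Finset.sum_add_distrib, ← Finset.mul_sum, Finset.sum_sub_distrib]
    ring

theorem dist_wordMap (n : ℕ) (w : Fin n → Fin 3) (x y : S.K) :
    dist (S.wordMap n w x) (S.wordMap n w y) = 2⁻¹ ^ n * dist x y := by
  induction n with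
  | zero => simp [wordMap]
  | succ n ih =>
    simp only [wordMap, ContinuousMap.comp_apply, dist_phi, ih]
    ring

theorem exists_tendsto_discreteEnergyIntegral (f : S.F) (g : C(S.K, ℝ)) :
    ∃ a, Tendsto (fun n => S.discreteEnergyIntegral n f g) atTop (𝓝 a) := by
  refine cauchySeq_tendsto_of_complete (Metric.cauchySeq_iff'.mpr fun ε hε => ?_)
  set L := energy f f with hL
  have hL0 : 0 ≤ L := (S.discreteEnergy_self_nonneg 0 f).trans (discreteEnergy_le_energy f 0)
  set η := ε / (2 * (2 * L + ‖g‖ + 1)) with hη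
  have hpos : 0 < 2 * L + ‖g‖ + 1 := by positivity
  have hη0 : 0 < η := by positivity
  obtain ⟨δ, hδ, hgδ⟩ := Metric.uniformContinuous_iff.mp
    (CompactSpace.uniformContinuous_of_continuous g.continuous) η hη0
  obtain ⟨N₁, hN₁⟩ : ∃ N : ℕ, ∀ n ≥ N, L - η < S.discreteEnergy n f f :=
    eventually_atTop.mp ((tendsto_energy f f).eventually (lt_mem_nhds (by linarith)))
  obtain ⟨N₂, hN₂⟩ : ∃ N : ℕ, ∀ n ≥ N, (2⁻¹ : ℝ) ^ n * Metric.diam (Set.univ : Set S.K) < δ := by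
    have h := (tendsto_pow_atTop_nhds_zero_of_lt_one (r := (2⁻¹ : ℝ)) (by norm_num)
      (by norm_num)).mul_const (Metric.diam (Set.univ : Set S.K))
    rw [zero_mul] at h
    exact eventually_atTop.mp (h.eventually (gt_mem_nhds hδ))
  refine ⟨max N₁ N₂, fun n hn => ?_⟩
  obtain ⟨m, rfl⟩ := Nat.exists_eq_add_of_le' hn
  have h1 := hN₁ (max N₁ N₂) (le_max_left _ _)
  have h2 := hN₂ (max N₁ N₂) (le_max_right _ _)
  have h3 := abs_discreteEnergyIntegral_add_sub_le (S := S) (max N₁ N₂) m f g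
    (M := ‖g‖) (ω := η) (fun x => g.norm_coe_le_norm x) (fun w x y => by
      rw [← Real.dist_eq]
      refine (hgδ ?_).le
      rw [dist_wordMap]
      refine lt_of_le_of_lt ?_ h2
      gcongr
      exact Metric.dist_le_diam_of_mem isCompact_univ.isBounded (Set.mem_univ _) (Set.mem_univ _))
  have h4 := discreteEnergy_le_energy f (m + max N₁ N₂)
  rw [Real.dist_eq]
  refine h3.trans_lt ?_
  have h5 : 2 * η * S.discreteEnergy (m + max N₁ N₂) f f ≤ 2 * η * L := by gcongr
  have h6 : ‖g‖ * (S.discreteEnergy (m + max N₁ N₂) f f - S.discreteEnergy (max N₁ N₂) f f) ≤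
      ‖g‖ * η := by
    gcongr
    linarith
  have h7 : η * (2 * (2 * L + ‖g‖ + 1)) = ε := by
    rw [hη]; field_simp
  nlinarith [norm_nonneg g]

/-- `μ` is the energy measure of `f`: the finite Borel measure that is the weak limit of the
discrete energy measures of `f`. Since
`E_n(f * g, f) - E_n(f ^ 2, g) / 2 = discreteEnergyIntegral n f g`, this says
`∫ g dμ = E(f * g, f) - E(f ^ 2, g) / 2` for `g` of finite energy; the total mass is `E(f, f)`. -/
def IsEnergyMeasure (f : S.F) (μ : Measure S.K) : Prop :=
  IsFiniteMeasure μ ∧ ∀ g : C(S.K, ℝ),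
    Tendsto (fun n => S.discreteEnergyIntegral n f g) atTop (𝓝 (∫ x, g x ∂μ))

theorem exists_isEnergyMeasure (f : S.F) : ∃ μ : Measure S.K, IsEnergyMeasure f μ := by
  choose l hl using fun g : C(S.K, ℝ) => exists_tendsto_discreteEnergyIntegral f g
  let Λ : CompactlySupportedContinuousMap S.K ℝ →ₚ[ℝ] ℝ :=
    { toFun := fun g => l g
      map_add' := fun g g' => by
        refine tendsto_nhds_unique (hl _) (((hl g).add (hl g')).congr fun n => ?_)
        simp only [discreteEnergyIntegral, Finset.mul_sum, ← Finset.sum_add_distrib]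
        refine Finset.sum_congr rfl fun _ _ => Finset.sum_congr rfl fun _ _ => ?_
        simp
        ring
      map_smul' := fun c g => by
        refine tendsto_nhds_unique (hl _) (((hl g).const_mul c).congr fun n => ?_)
        simp only [discreteEnergyIntegral, Finset.mul_sum]
        refine Finset.sum_congr rfl fun _ _ => Finset.sum_congr rfl fun _ _ => ?_
        simp
        ring
      monotone' := fun g g' hgg => by
        refine le_of_tendsto_of_tendsto' (hl _) (hl _) fun n => ?_
        simp only [discreteEnergyIntegral]
        gcongr
        · exact hgg _
        · exact hgg _ }
  refine ⟨RealRMK.rieszMeasure Λ, inferInstance, fun g => ?_⟩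
  have h := RealRMK.integral_rieszMeasure Λ ⟨g, HasCompactSupport.of_compactSpace g⟩
  have h' : ∫ x, g x ∂(RealRMK.rieszMeasure Λ) = l g := h
  rw [h']
  exact hl g

/-- The energy measure `ν_f` of a function `f` of finite energy. -/
def energyMeasure (f : S.F) : Measure S.K := (exists_isEnergyMeasure f).choose

theorem isEnergyMeasure_energyMeasure (f : S.F) : IsEnergyMeasure f (energyMeasure f) :=
  (exists_isEnergyMeasure f).choose_spec

instance (f : S.F) : IsFiniteMeasure (energyMeasure f) := (isEnergyMeasure_energyMeasure f).1

theorem rnDeriv_sum_smul {ι : Type*} (s : Finset ι) (c : ι → NNReal) (μ : ι → Measure S.K)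
    [∀ k, IsFiniteMeasure (μ k)] (ν : Measure S.K) [IsFiniteMeasure ν] :
    ∀ᵐ x ∂ν, ((∑ k ∈ s, c k • μ k).rnDeriv ν x).toReal =
      ∑ k ∈ s, (c k : ℝ) * ((μ k).rnDeriv ν x).toReal := by
  classical
  induction s using Finset.induction_on with
  | empty =>
    filter_upwards [Measure.rnDeriv_zero ν] with x hx
    simp [hx]
  | insert k s hk ih =>
    have hfin : IsFiniteMeasure (∑ k ∈ s, c k • μ k) := by
      refine ⟨?_⟩
      rw [Measure.finsetSum_apply]
      exact ENNReal.sum_lt_top.mpr fun k _ => measure_lt_top _ _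
    rw [Finset.sum_insert hk]
    have hk1 : (μ k).HaveLebesgueDecomposition ν :=
      Measure.haveLebesgueDecomposition_of_sigmaFinite _ _
    have hk2 : (c k • μ k).HaveLebesgueDecomposition ν :=
      Measure.haveLebesgueDecomposition_of_sigmaFinite _ _
    have hk3 : (∑ k ∈ s, c k • μ k).HaveLebesgueDecomposition ν :=
      Measure.haveLebesgueDecomposition_of_sigmaFinite _ _
    have hk4 : (c k • μ k + ∑ k ∈ s, c k • μ k).HaveLebesgueDecomposition ν :=
      Measure.haveLebesgueDecomposition_of_sigmaFinite _ _
    filter_upwards [ih, Measure.rnDeriv_add (c k • μ k) (∑ k ∈ s, c k • μ k) ν,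
      Measure.rnDeriv_smul_left (μ k) ν (c k), (μ k).rnDeriv_lt_top ν,
      (∑ k ∈ s, c k • μ k).rnDeriv_lt_top ν] with x h1 h2 h3 h4 h5
    rw [Finset.sum_insert hk, ← h1, h2, Pi.add_apply, h3, Pi.smul_apply,
      ENNReal.toReal_add (by rw [ENNReal.smul_def]; exact ENNReal.mul_ne_top (by simp) h4.ne) h5.ne]
    rw [ENNReal.smul_def, smul_eq_mul, ENNReal.toReal_mul, ENNReal.coe_toReal]

theorem sum_rnDeriv_energyMeasure_eq_zero {ι : Type*} [Fintype ι] (c : ι → ℝ) (f : ι → S.F)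
    (h : ∀ n g, ∑ k, c k * S.discreteEnergyIntegral n (f k) g = 0)
    (ν : Measure S.K) [IsFiniteMeasure ν] :
    ∀ᵐ x ∂ν, ∑ k, c k * ((energyMeasure (f k)).rnDeriv ν x).toReal = 0 := by
  have hlim : ∀ g : C(S.K, ℝ), ∑ k, c k * ∫ x, g x ∂(energyMeasure (f k)) = 0 := fun g =>
    tendsto_nhds_unique ((tendsto_finsetSum _ fun k _ =>
      ((isEnergyMeasure_energyMeasure (f k)).2 g).const_mul (c k)).congr fun n => h n g)
      tendsto_const_nhds
  have hfin : ∀ c : ι → NNReal, IsFiniteMeasure (∑ k, c k • energyMeasure (f k)) := fun c => by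
    refine ⟨?_⟩
    rw [Measure.finsetSum_apply]
    exact ENNReal.sum_lt_top.mpr fun k _ => measure_lt_top _ _
  have hint : ∀ (c : ι → NNReal) (g : BoundedContinuousFunction S.K ℝ),
      ∫ x, g x ∂(∑ k, c k • energyMeasure (f k)) =
        ∑ k, (c k : ℝ) * ∫ x, g x ∂(energyMeasure (f k)) := fun c g => by
    rw [integral_finsetSum_measure fun k _ => g.integrable _]
    simp [integral_smul_nnreal_measure, NNReal.smul_def]
  have heq : ∑ k, (c k).toNNReal • energyMeasure (f k) =
      ∑ k, (-c k).toNNReal • energyMeasure (f k) := by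
    have := hfin fun k => (c k).toNNReal
    have := hfin fun k => (-c k).toNNReal
    refine ext_of_forall_integral_eq_of_IsFiniteMeasure fun g => ?_
    rw [hint, hint, ← sub_eq_zero, ← Finset.sum_sub_distrib, ← hlim g.toContinuousMap]
    refine Finset.sum_congr rfl fun k _ => ?_
    rw [← sub_mul, Real.coe_toNNReal', Real.coe_toNNReal', max_zero_sub_max_neg_zero_eq_self]
    rfl
  filter_upwards [rnDeriv_sum_smul Finset.univ (fun k => (c k).toNNReal)
      (fun k => energyMeasure (f k)) ν,
    rnDeriv_sum_smul Finset.univ (fun k => (-c k).toNNReal)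
      (fun k => energyMeasure (f k)) ν] with x h1 h2
  rw [heq, h2, ← sub_eq_zero, ← Finset.sum_sub_distrib, ← neg_eq_zero,
    ← Finset.sum_neg_distrib] at h1
  rw [← h1]
  refine Finset.sum_congr rfl fun k _ => ?_
  rw [← sub_mul, Real.coe_toNNReal', Real.coe_toNNReal', ← neg_mul, neg_sub,
    max_zero_sub_max_neg_zero_eq_self]

variable (S) in
/-- A function `u` on the gasket is harmonic (with respect to the boundary formed by the three
vertices) if its energy is the minimal one for its boundary values, `E_n(u) = E_0(u)` for all `n`;
recall that `E_n(u)` is nondecreasing in `n` and that `E_0(u)` depends on the boundary values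
of `u` only. -/
def IsHarmonic (u : S.F) : Prop := ∀ n, S.discreteEnergy n u u = S.discreteEnergy 0 u u

theorem const_mem (c : ℝ) : ContinuousMap.const S.K c ∈ S.F := by
  refine ⟨0, ?_⟩
  rintro _ ⟨n, rfl⟩
  simp [discreteEnergy]

variable (S) in
/-- A complete energy orthonormal system `h 0, h 1` for the space of nonconstant harmonic
functions, that is, for the harmonic functions modulo constants. -/
structure HarmonicSystem where
  h : Fin 2 → S.F
  harmonic : ∀ i, S.IsHarmonic (h i)
  orthonormal : ∀ i j, energy (h i) (h j) = if i = j then 1 else 0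
  complete : ∀ u : S.F, S.IsHarmonic u →
    ∃ a : Fin 2 → ℝ, ∃ c : ℝ, u = ∑ i, a i • h i + ⟨ContinuousMap.const S.K c, const_mem c⟩

variable (ψ : S.HarmonicSystem)

/-- The Kusuoka energy measure `ν = ν_{h 0} + ν_{h 1}`. -/
def kusuokaMeasure : Measure S.K := energyMeasure (ψ.h 0) + energyMeasure (ψ.h 1)

instance : IsFiniteMeasure (kusuokaMeasure ψ) := by
  unfold kusuokaMeasure
  infer_instance

/-- The density `Γ(f) = dν_f / dν`. -/
def gammaSelf (f : S.F) (x : S.K) : ℝ := ((energyMeasure f).rnDeriv (kusuokaMeasure ψ) x).toReal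

/-- The density `Γ(f, g)` of the mutual energy measure `ν_{f, g} = (ν_{f + g} - ν_{f - g}) / 4`
with respect to `ν`. -/
def gamma (f g : S.F) (x : S.K) : ℝ := (gammaSelf ψ (f + g) x - gammaSelf ψ (f - g) x) / 4

theorem gammaSelf_sum_eq_zero {ι : Type*} [Fintype ι] (c : ι → ℝ) (f : ι → S.F)
    (h : ∀ x y : S.K, ∑ k, c k * ((f k : C(S.K, ℝ)) x - (f k : C(S.K, ℝ)) y) ^ 2 = 0) :
    ∀ᵐ x ∂(kusuokaMeasure ψ), ∑ k, c k * gammaSelf ψ (f k) x = 0 := by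
  refine sum_rnDeriv_energyMeasure_eq_zero c f (fun n g => ?_) _
  simp only [discreteEnergyIntegral, Finset.mul_sum]
  rw [Finset.sum_comm]
  refine Finset.sum_eq_zero fun w _ => ?_
  rw [Finset.sum_comm]
  refine Finset.sum_eq_zero fun i _ => ?_
  have h' := h (S.wordMap n w (S.vertex i)) (S.wordMap n w (S.vertex (i + 1)))
  simp_rw [← mul_assoc, mul_comm (c _), mul_assoc]
  simp_rw [mul_left_comm (c _), ← Finset.mul_sum, h', mul_zero]

theorem gamma_comm (f g : S.F) :
    ∀ᵐ x ∂(kusuokaMeasure ψ), gamma ψ f g x = gamma ψ g f x := by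
  filter_upwards [gammaSelf_sum_eq_zero ψ ![1, -1] ![f - g, g - f] fun x y => by
    simp [Fin.sum_univ_succ]; ring] with x hx
  simp only [Fin.sum_univ_succ, Fin.sum_univ_zero, Matrix.cons_val_zero, Matrix.cons_val_succ] at hx
  simp only [gamma, add_comm g f]
  linarith

theorem gamma_self (f : S.F) :
    ∀ᵐ x ∂(kusuokaMeasure ψ), gamma ψ f f x = gammaSelf ψ f x := by
  filter_upwards [gammaSelf_sum_eq_zero ψ ![1, -1, -4] ![f + f, f - f, f] fun x y => by
    simp [Fin.sum_univ_succ]; ring] with x hx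
  simp only [Fin.sum_univ_succ, Fin.sum_univ_zero, Matrix.cons_val_zero, Matrix.cons_val_succ] at hx
  simp only [gamma]
  linarith

theorem gamma_add_left (f f' g : S.F) : ∀ᵐ x ∂(kusuokaMeasure ψ),
    gamma ψ (f + f') g x = gamma ψ f g x + gamma ψ f' g x := by
  filter_upwards [gammaSelf_sum_eq_zero ψ ![1, -1, -1, 1, -1, 1]
    ![f + f' + g, f + f' - g, f + g, f - g, f' + g, f' - g] fun x y => by
      simp [Fin.sum_univ_succ]; ring] with x hx
  simp only [Fin.sum_univ_succ, Fin.sum_univ_zero, Matrix.cons_val_zero, Matrix.cons_val_succ] at hx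
  simp only [gamma]
  linarith

theorem gamma_smul_left (r : ℝ) (f g : S.F) : ∀ᵐ x ∂(kusuokaMeasure ψ),
    gamma ψ (r • f) g x = r * gamma ψ f g x := by
  filter_upwards [gammaSelf_sum_eq_zero ψ ![1, -1, -r, r]
    ![r • f + g, r • f - g, f + g, f - g] fun x y => by
      simp [Fin.sum_univ_succ]; ring] with x hx
  simp only [Fin.sum_univ_succ, Fin.sum_univ_zero, Matrix.cons_val_zero, Matrix.cons_val_succ] at hx
  simp only [gamma]
  linarith

theorem gamma_integrable (f g : S.F) : Integrable (gamma ψ f g) (kusuokaMeasure ψ) :=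
  (Measure.integrable_toReal_rnDeriv.sub Measure.integrable_toReal_rnDeriv).div_const 4

variable (S) in
/-- The complexification `F_ℂ = F + iF`. -/
def FC : Submodule ℂ C(S.K, ℂ) where
  carrier := {u | Complex.reCLM.compLeftContinuous ℝ S.K u ∈ S.F ∧
    Complex.imCLM.compLeftContinuous ℝ S.K u ∈ S.F}
  zero_mem' := by simp
  add_mem' := fun hu hv => by
    simp only [Set.mem_ofPred_eq, map_add]
    exact ⟨S.F.add_mem hu.1 hv.1, S.F.add_mem hu.2 hv.2⟩
  smul_mem' := fun c u hu => by
    refine ⟨?_, ?_⟩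
    · convert S.F.sub_mem (S.F.smul_mem c.re hu.1) (S.F.smul_mem c.im hu.2) using 1
      ext x
      simp
    · convert S.F.add_mem (S.F.smul_mem c.re hu.2) (S.F.smul_mem c.im hu.1) using 1
      ext x
      simp

/-- The real part of `u ∈ F_ℂ`. -/
def rePart (u : S.FC) : S.F := ⟨Complex.reCLM.compLeftContinuous ℝ S.K u, u.2.1⟩

/-- The imaginary part of `u ∈ F_ℂ`. -/
def imPart (u : S.FC) : S.F := ⟨Complex.imCLM.compLeftContinuous ℝ S.K u, u.2.2⟩

theorem rePart_add (u v : S.FC) : rePart (u + v) = rePart u + rePart v := by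
  ext x; simp [rePart]

theorem imPart_add (u v : S.FC) : imPart (u + v) = imPart u + imPart v := by
  ext x; simp [imPart]

theorem rePart_smul (c : ℂ) (u : S.FC) :
    rePart (c • u) = c.re • rePart u + (-c.im) • imPart u := by
  ext x; simp [rePart, imPart, sub_eq_add_neg]

theorem imPart_smul (c : ℂ) (u : S.FC) : imPart (c • u) = c.re • imPart u + c.im • rePart u := by
  ext x; simp [rePart, imPart]

/-- The complexified energy form on `F_ℂ`, linear in the first argument. -/
def energyC (f g : S.FC) : ℂ :=
  energy (rePart f) (rePart g) - Complex.I * energy (rePart f) (imPart g) +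
    Complex.I * energy (imPart f) (rePart g) + energy (imPart f) (imPart g)

/-- The complexified density `Γ(f, g)` of the mutual energy measure, linear in the first
argument. -/
def gammaC (f g : S.FC) (x : S.K) : ℂ :=
  gamma ψ (rePart f) (rePart g) x - Complex.I * gamma ψ (rePart f) (imPart g) x +
    Complex.I * gamma ψ (imPart f) (rePart g) x + gamma ψ (imPart f) (imPart g) x

theorem gammaC_add_left (f f' g : S.FC) : ∀ᵐ x ∂(kusuokaMeasure ψ),
    gammaC ψ (f + f') g x = gammaC ψ f g x + gammaC ψ f' g x := by
  simp only [gammaC, rePart_add, imPart_add]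
  filter_upwards [gamma_add_left ψ (rePart f) (rePart f') (rePart g),
    gamma_add_left ψ (rePart f) (rePart f') (imPart g),
    gamma_add_left ψ (imPart f) (imPart f') (rePart g),
    gamma_add_left ψ (imPart f) (imPart f') (imPart g)] with x h1 h2 h3 h4
  rw [h1, h2, h3, h4]
  push_cast
  ring

theorem gammaC_smul_left (c : ℂ) (f g : S.FC) : ∀ᵐ x ∂(kusuokaMeasure ψ),
    gammaC ψ (c • f) g x = c * gammaC ψ f g x := by
  have key : ∀ (a b : ℝ) (u v w : S.F), ∀ᵐ x ∂(kusuokaMeasure ψ),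
      gamma ψ (a • u + b • v) w x = a * gamma ψ u w x + b * gamma ψ v w x := by
    intro a b u v w
    filter_upwards [gamma_add_left ψ (a • u) (b • v) w, gamma_smul_left ψ a u w,
      gamma_smul_left ψ b v w] with x h1 h2 h3
    rw [h1, h2, h3]
  simp only [gammaC, rePart_smul, imPart_smul]
  filter_upwards [key c.re (-c.im) (rePart f) (imPart f) (rePart g),
    key c.re (-c.im) (rePart f) (imPart f) (imPart g),
    key c.re c.im (imPart f) (rePart f) (rePart g),
    key c.re c.im (imPart f) (rePart f) (imPart g)] with x h1 h2 h3 h4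
  rw [h1, h2, h3, h4]
  apply Complex.ext <;> simp <;> ring

theorem gammaC_conj (f g : S.FC) : ∀ᵐ x ∂(kusuokaMeasure ψ),
    conj (gammaC ψ f g x) = gammaC ψ g f x := by
  filter_upwards [gamma_comm ψ (rePart f) (rePart g), gamma_comm ψ (rePart f) (imPart g),
    gamma_comm ψ (imPart f) (rePart g), gamma_comm ψ (imPart f) (imPart g)] with x h1 h2 h3 h4
  simp only [gammaC, h1, h2, h3, h4]
  apply Complex.ext <;> simp
  ring

theorem gammaC_self_nonneg (f : S.FC) : ∀ᵐ x ∂(kusuokaMeasure ψ), 0 ≤ (gammaC ψ f f x).re := by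
  filter_upwards [gamma_self ψ (rePart f), gamma_self ψ (imPart f)] with x h1 h2
  simp [gammaC, h1, h2, gammaSelf, add_nonneg]

theorem gammaC_integrable (f g : S.FC) : Integrable (gammaC ψ f g) (kusuokaMeasure ψ) :=
  (((gamma_integrable ψ _ _).ofReal.sub ((gamma_integrable ψ _ _).ofReal.const_mul _)).add
    ((gamma_integrable ψ _ _).ofReal.const_mul _)).add (gamma_integrable ψ _ _).ofReal

theorem weighted_gammaC_integrable (a c : S.FC) (b d : C(S.K, ℂ)) :
    Integrable (fun x => b x * conj (d x) * gammaC ψ a c x) (kusuokaMeasure ψ) :=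
  (gammaC_integrable ψ a c).bdd_mul
    (f := fun x => b x * conj (d x)) (c := ‖b * star d‖)
    (by fun_prop) (Eventually.of_forall fun x => (b * star d).norm_coe_le_norm x)

/-- The functional `a ⊗ b ↦ ∫ b * conj d * Γ(a, c) dν` on `F_ℂ ⊗ F_ℂ`. -/
def formAux (c d : S.FC) : S.FC ⊗[ℂ] S.FC →ₗ[ℂ] ℂ :=
  TensorProduct.lift (LinearMap.mk₂ ℂ
    (fun a b => ∫ x, (b : C(S.K, ℂ)) x * conj ((d : C(S.K, ℂ)) x) * gammaC ψ a c x
      ∂(kusuokaMeasure ψ))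
    (fun a a' b => by
      rw [← integral_add (weighted_gammaC_integrable ψ a c b d)
        (weighted_gammaC_integrable ψ a' c b d)]
      refine integral_congr_ae ?_
      filter_upwards [gammaC_add_left ψ a a' c] with x hx
      rw [hx]
      ring)
    (fun r a b => by
      rw [smul_eq_mul, ← integral_const_mul]
      refine integral_congr_ae ?_
      filter_upwards [gammaC_smul_left ψ r a c] with x hx
      rw [hx]
      ring)
    (fun a b b' => by
      rw [← integral_add (weighted_gammaC_integrable ψ a c b d)
        (weighted_gammaC_integrable ψ a c b' d)]
      refine integral_congr_ae (Eventually.of_forall fun x => ?_)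
      simp only [Submodule.coe_add, ContinuousMap.add_apply]
      ring)
    (fun r a b => by
      rw [smul_eq_mul, ← integral_const_mul]
      refine integral_congr_ae (Eventually.of_forall fun x => ?_)
      simp only [Submodule.coe_smul, ContinuousMap.smul_apply, smul_eq_mul]
      ring))

theorem formAux_tmul (a b c d : S.FC) : formAux ψ c d (a ⊗ₜ b) =
    ∫ x, (b : C(S.K, ℂ)) x * conj ((d : C(S.K, ℂ)) x) * gammaC ψ a c x ∂(kusuokaMeasure ψ) := rfl

theorem conj_formAux_tmul (a b c d : S.FC) :
    conj (formAux ψ c d (a ⊗ₜ b)) = formAux ψ a b (c ⊗ₜ d) := by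
  rw [formAux_tmul, formAux_tmul, ← integral_conj]
  refine integral_congr_ae ?_
  filter_upwards [gammaC_conj ψ a c] with x hx
  rw [map_mul, map_mul, hx, Complex.conj_conj]
  ring

/-- The sesquilinear form `⟨a ⊗ b, c ⊗ d⟩ = ∫ b * conj d * Γ(a, c) dν` on `F_ℂ ⊗ F_ℂ`. The conjugate linear
argument is written first: `form ψ (c ⊗ d) (a ⊗ b) = ⟨a ⊗ b, c ⊗ d⟩`. -/
def form : S.FC ⊗[ℂ] S.FC →ₗ⋆[ℂ] S.FC ⊗[ℂ] S.FC →ₗ[ℂ] ℂ :=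
  TensorProduct.lift (LinearMap.mk₂'ₛₗ (starRingEnd ℂ) (starRingEnd ℂ) (formAux ψ)
    (fun c c' d => TensorProduct.ext' fun a b => by
      rw [LinearMap.add_apply, ← conj_formAux_tmul ψ (c + c') d a b,
        ← conj_formAux_tmul ψ c d a b, ← conj_formAux_tmul ψ c' d a b,
        TensorProduct.add_tmul, map_add, map_add])
    (fun r c d => TensorProduct.ext' fun a b => by
      rw [LinearMap.smul_apply, ← Complex.conj_conj (formAux ψ (r • c) d _), conj_formAux_tmul,
        ← TensorProduct.smul_tmul', map_smul, smul_eq_mul, map_mul, conj_formAux_tmul,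
        smul_eq_mul])
    (fun c d d' => TensorProduct.ext' fun a b => by
      rw [LinearMap.add_apply, ← conj_formAux_tmul ψ c (d + d') a b,
        ← conj_formAux_tmul ψ c d a b, ← conj_formAux_tmul ψ c d' a b,
        TensorProduct.tmul_add, map_add, map_add])
    (fun r c d => TensorProduct.ext' fun a b => by
      rw [LinearMap.smul_apply, ← Complex.conj_conj (formAux ψ c (r • d) _), conj_formAux_tmul,
        TensorProduct.tmul_smul, map_smul, smul_eq_mul, map_mul, conj_formAux_tmul,
        smul_eq_mul]))

theorem form_tmul (a b c d : S.FC) : form ψ (c ⊗ₜ d) (a ⊗ₜ b) =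
    ∫ x, (b : C(S.K, ℂ)) x * conj ((d : C(S.K, ℂ)) x) * gammaC ψ a c x ∂(kusuokaMeasure ψ) := rfl

theorem form_conj_symm (s t : S.FC ⊗[ℂ] S.FC) : conj (form ψ t s) = form ψ s t := by
  induction s using TensorProduct.induction_on with
  | zero => simp
  | add s s' h h' => simp [h, h']
  | tmul a b =>
    induction t using TensorProduct.induction_on with
    | zero => simp
    | add t t' h h' => simp [h, h']
    | tmul c d => exact conj_formAux_tmul ψ a b c d

theorem gammaC_posSemidef {n : ℕ} (a : Fin n → S.FC) : ∀ᵐ x ∂(kusuokaMeasure ψ),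
    ∀ z : Fin n → ℂ, 0 ≤ (∑ i, ∑ j, z j * conj (z i) * gammaC ψ (a j) (a i) x).re := by
  have hsum : ∀ {m : ℕ} (z : Fin m → ℂ) (a : Fin m → S.FC) (g : S.FC), ∀ᵐ x ∂(kusuokaMeasure ψ),
      gammaC ψ (∑ j, z j • a j) g x = ∑ j, z j * gammaC ψ (a j) g x := by
    intro m z a g
    induction m with
    | zero =>
      filter_upwards [gammaC_smul_left ψ 0 0 g] with x hx
      simpa using hx
    | succ m ih =>
      filter_upwards [ih (z ∘ Fin.succ) (a ∘ Fin.succ),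
        gammaC_add_left ψ (z 0 • a 0) (∑ j : Fin m, z j.succ • a j.succ) g,
        gammaC_smul_left ψ (z 0) (a 0) g] with x h1 h2 h3
      rw [Fin.sum_univ_succ, Fin.sum_univ_succ, h2, h3]
      congr 1
  have hfix : ∀ z : Fin n → ℂ, ∀ᵐ x ∂(kusuokaMeasure ψ),
      0 ≤ (∑ i, ∑ j, z j * conj (z i) * gammaC ψ (a j) (a i) x).re := by
    intro z
    filter_upwards [gammaC_self_nonneg ψ (∑ j, z j • a j), hsum z a (∑ j, z j • a j),
      ae_all_iff.mpr fun j => gammaC_conj ψ (∑ j, z j • a j) (a j),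
      ae_all_iff.mpr fun i => hsum z a (a i),
      ae_all_iff.mpr fun i => ae_all_iff.mpr fun j => gammaC_conj ψ (a i) (a j)]
      with x h1 h2 h3 h4 h5
    rw [h2] at h1
    rw [Finset.sum_comm]
    convert h1 using 2
    refine Finset.sum_congr rfl fun j _ => ?_
    rw [← h3 j, h4 j, map_sum, Finset.mul_sum]
    refine Finset.sum_congr rfl fun i _ => ?_
    rw [map_mul, h5]
    ring
  filter_upwards [ae_all_iff.mpr fun k => hfix (TopologicalSpace.denseSeq (Fin n → ℂ) k)]
    with x hx z
  have hclosed : IsClosed {z : Fin n → ℂ |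
      0 ≤ (∑ i, ∑ j, z j * conj (z i) * gammaC ψ (a j) (a i) x).re} :=
    isClosed_le continuous_const (by fun_prop)
  have hsub : Set.range (TopologicalSpace.denseSeq (Fin n → ℂ)) ⊆ {z : Fin n → ℂ |
      0 ≤ (∑ i, ∑ j, z j * conj (z i) * gammaC ψ (a j) (a i) x).re} := by
    rintro _ ⟨k, rfl⟩
    exact hx k
  exact hclosed.closure_subset_iff.mpr hsub (TopologicalSpace.denseRange_denseSeq _ z)

theorem form_self_nonneg (t : S.FC ⊗[ℂ] S.FC) : 0 ≤ (form ψ t t).re := by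
  obtain ⟨n, a, b, rfl⟩ : ∃ (n : ℕ) (a b : Fin n → S.FC), t = ∑ i, a i ⊗ₜ[ℂ] b i := by
    induction t using TensorProduct.induction_on with
    | zero => exact ⟨0, ![], ![], by simp⟩
    | tmul a b => exact ⟨1, ![a], ![b], by simp⟩
    | add s t hs ht =>
      obtain ⟨n, a, b, rfl⟩ := hs
      obtain ⟨m, c, d, rfl⟩ := ht
      exact ⟨n + m, Fin.append a c, Fin.append b d, by simp [Fin.sum_univ_add]⟩
  simp only [map_sum, LinearMap.sum_apply, form_tmul]
  rw [Finset.sum_congr rfl fun i _ => (integral_finsetSum _ fun j _ =>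
      weighted_gammaC_integrable ψ (a i) (a j) (b i : C(S.K, ℂ)) (b j)).symm,
    ← integral_finsetSum _ fun i _ => integrable_finsetSum _ fun j _ =>
      weighted_gammaC_integrable ψ (a i) (a j) (b i : C(S.K, ℂ)) (b j),
    ← RCLike.re_eq_complex_re, ← integral_re (integrable_finsetSum _ fun i _ =>
      integrable_finsetSum _ fun j _ =>
      weighted_gammaC_integrable ψ (a i) (a j) (b i : C(S.K, ℂ)) (b j))]
  refine integral_nonneg_of_ae ?_
  filter_upwards [gammaC_posSemidef ψ a] with x hx
  have h := hx fun i => (b i : C(S.K, ℂ)) x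
  rw [Finset.sum_comm] at h
  exact h

/-- `F_ℂ ⊗ F_ℂ` with the scalar product `form`. -/
def PreForm (_ : S.HarmonicSystem) : Type := S.FC ⊗[ℂ] S.FC

instance : AddCommGroup (PreForm ψ) := inferInstanceAs (AddCommGroup (S.FC ⊗[ℂ] S.FC))

instance : Module ℂ (PreForm ψ) := inferInstanceAs (Module ℂ (S.FC ⊗[ℂ] S.FC))

instance preFormCore : PreInnerProductSpace.Core ℂ (PreForm ψ) where
  inner s t := form ψ s t
  conj_inner_symm s t := form_conj_symm ψ s t
  re_inner_nonneg t := form_self_nonneg ψ t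
  add_left s s' t := LinearMap.map_add₂ (form ψ) s s' t
  smul_left s t r := LinearMap.map_smulₛₗ₂ (form ψ) r s t

instance : SeminormedAddCommGroup (PreForm ψ) :=
  InnerProductSpace.Core.toSeminormedAddCommGroup (𝕜 := ℂ)

instance : InnerProductSpace ℂ (PreForm ψ) := InnerProductSpace.ofCore (preFormCore ψ)

/-- The Hilbert space `H_ℂ` of 1-forms (vector fields): the Hausdorff completion of
`F_ℂ ⊗ F_ℂ`, that is, trivial elements are factored out and the quotient is completed. -/
abbrev OneForm : Type := UniformSpace.Completion (PreForm ψ)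

theorem one_mem_FC : (1 : C(S.K, ℂ)) ∈ S.FC := by
  refine ⟨?_, ?_⟩
  · convert const_mem (S := S) 1 using 1
    ext x
    simp
  · convert const_mem (S := S) 0 using 1
    ext x
    simp

/-- The element of `H_ℂ` given by an element of `F_ℂ ⊗ F_ℂ`. -/
def toOneForm : S.FC ⊗[ℂ] S.FC →ₗ[ℂ] OneForm ψ :=
  (UniformSpace.Completion.toComplL (𝕜 := ℂ) (E := PreForm ψ)).toLinearMap

/-- The derivation `∂ f = f ⊗ 1`. -/
def derivation : S.FC →ₗ[ℂ] OneForm ψ :=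
  toOneForm ψ ∘ₗ (TensorProduct.mk ℂ S.FC S.FC).flip ⟨1, one_mem_FC⟩

/-- `L_{2,ℂ}(K, ν)`. -/
abbrev L2 : Type := Lp ℂ 2 (kusuokaMeasure ψ)

/-- The class of a function in `F_ℂ` in `L_{2,ℂ}(K, ν)`. -/
def toL2 : S.FC →ₗ[ℂ] L2 ψ :=
  (ContinuousMap.toLp 2 (kusuokaMeasure ψ) ℂ).toLinearMap ∘ₗ S.FC.subtype

/-- The graph of `∂*`: the pairs `(v, v')` with `⟨v', u⟩ = -⟨v, ∂ u⟩` for all `u ∈ F_ℂ`. -/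
def divergenceGraph : Submodule ℂ (OneForm ψ × L2 ψ) where
  carrier := {q | ∀ u : S.FC, inner ℂ (toL2 ψ u) q.2 = -inner ℂ (derivation ψ u) q.1}
  zero_mem' u := by simp
  add_mem' hq hr u := by simp [inner_add_right, hq u, hr u, add_comm]
  smul_mem' c q hq u := by simp [inner_smul_right, hq u]

/-- The divergence `∂*`, as an unbounded operator from `H_ℂ` to `L_{2,ℂ}(K, ν)`. -/
def divergence : OneForm ψ →ₗ.[ℂ] L2 ψ := (divergenceGraph ψ).toLinearPMap

theorem energy_add_right (f g g' : S.F) : energy f (g + g') = energy f g + energy f g' := by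
  refine tendsto_nhds_unique (tendsto_energy f (g + g'))
    (((tendsto_energy f g).add (tendsto_energy f g')).congr fun n => ?_)
  simp only [discreteEnergy, Finset.mul_sum, ← Finset.sum_add_distrib, Submodule.coe_add,
    ContinuousMap.add_apply]
  refine Finset.sum_congr rfl fun _ _ => Finset.sum_congr rfl fun _ _ => ?_
  ring

theorem energy_smul_right (r : ℝ) (f g : S.F) : energy f (r • g) = r * energy f g := by
  refine tendsto_nhds_unique (tendsto_energy f (r • g))
    (((tendsto_energy f g).const_mul r).congr fun n => ?_)
  simp only [discreteEnergy, Finset.mul_sum, Submodule.coe_smul, ContinuousMap.smul_apply,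
    smul_eq_mul]
  refine Finset.sum_congr rfl fun _ _ => Finset.sum_congr rfl fun _ _ => ?_
  ring

theorem energyC_add_right (f g g' : S.FC) : energyC f (g + g') = energyC f g + energyC f g' := by
  simp only [energyC, rePart_add, imPart_add, energy_add_right]
  push_cast
  ring

theorem energyC_smul_right (c : ℂ) (f g : S.FC) : energyC f (c • g) = conj c * energyC f g := by
  simp only [energyC, rePart_smul, imPart_smul, energy_add_right, energy_smul_right]
  apply Complex.ext <;> simp <;> ring

/-- The graph of `Δ_ν`: the pairs `(g, w)` with `g ∈ F_ℂ` and `E(f, g) = -⟨f, w⟩` for all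
`f ∈ F_ℂ`. -/
def laplacianGraph : Submodule ℂ (L2 ψ × L2 ψ) where
  carrier := {q | ∃ g : S.FC, toL2 ψ g = q.1 ∧
    ∀ f : S.FC, energyC f g = -inner ℂ q.2 (toL2 ψ f)}
  zero_mem' := by
    refine ⟨0, map_zero _, fun f => ?_⟩
    have h := energyC_smul_right 0 f 0
    simpa using h
  add_mem' := by
    rintro q r ⟨g, hg, hq⟩ ⟨g', hg', hr⟩
    refine ⟨g + g', by rw [map_add, hg, hg', Prod.fst_add], fun f => ?_⟩
    rw [energyC_add_right, hq, hr, Prod.snd_add, inner_add_left, neg_add]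
  smul_mem' := by
    rintro c q ⟨g, hg, hq⟩
    refine ⟨c • g, by rw [map_smul, hg, Prod.smul_fst], fun f => ?_⟩
    rw [energyC_smul_right, hq, Prod.smul_snd, inner_smul_left, mul_neg]

/-- The energy Laplacian `Δ_ν`, the self-adjoint operator on `L_{2,ℂ}(K, ν)` associated with the
closed form `(E, F_ℂ)`. -/
def laplacian : L2 ψ →ₗ.[ℂ] L2 ψ := (laplacianGraph ψ).toLinearPMap

/-- The kernel of `∂*`. -/
def kerDivergence : Set (OneForm ψ) :=
  {w | ∃ hw : w ∈ (divergence ψ).domain, divergence ψ ⟨w, hw⟩ = 0}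

end SierpinskiGasket

end

open SierpinskiGasket

namespace SierpinskiGasket

variable {S : SierpinskiGasket}

/-! The derivation is an isometry for the energy, `⟨∂f, ∂g⟩ = E(f, g)` (`inner_derivation`), and its
range is closed (`isClosed_range_derivation`). Hence every `v` in the Hilbert space of 1-forms
splits as `∂f + w` with `w` orthogonal to the range of `∂`, which is exactly `∂*w = 0`. Subtracting
`w` does not affect membership in `dom ∂*`, and for `∂f` the equation defining `∂*` is, after
conjugation, the equation defining `Δ_ν f`. This gives all three claims.

The work lies in the inputs. The isometry needs `∫ Γ(f, g) dν = E(f, g)`, that is, `ν_f ≪ ν` for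
every `f` of finite energy (`energyMeasure_absolutelyContinuous`). This follows from the bound
`ν_f(A) ≤ 2 (E(f, f) - E_n(f, f))` on `ν`-null sets `A`, in which `n` tends to infinity. Closedness
of the range is completeness of `F` modulo constants (`exists_energy_limit`), resting on the
estimate of the oscillation of `f` by `√E(f, f)`.

Finally, both operators are given by graphs, which must be shown to be single-valued. This uses
density of `F_ℂ` in `L_2` (Stone-Weierstrass, harmonic functions separating points) and, for `Δ_ν`,
full support of `ν`, so that an `L_2` class determines its representative in `F_ℂ`. -/

/-! ### Bilinearity of the discrete and limit energies -/

theorem discreteEnergy_comm (n : ℕ) (u v : C(S.K, ℝ)) :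
    S.discreteEnergy n u v = S.discreteEnergy n v u := by
  rw [discreteEnergy, discreteEnergy]
  exact congrArg _ (Finset.sum_congr rfl fun _ _ => Finset.sum_congr rfl fun _ _ => mul_comm _ _)

theorem discreteEnergy_add_left (n : ℕ) (u u' v : C(S.K, ℝ)) :
    S.discreteEnergy n (u + u') v = S.discreteEnergy n u v + S.discreteEnergy n u' v := by
  simp only [discreteEnergy, Finset.mul_sum, ← Finset.sum_add_distrib, ContinuousMap.add_apply]
  refine Finset.sum_congr rfl fun _ _ => Finset.sum_congr rfl fun _ _ => ?_
  ring

theorem discreteEnergy_smul_left (n : ℕ) (c : ℝ) (u v : C(S.K, ℝ)) :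
    S.discreteEnergy n (c • u) v = c * S.discreteEnergy n u v := by
  simp only [discreteEnergy, Finset.mul_sum, ContinuousMap.smul_apply, smul_eq_mul]
  refine Finset.sum_congr rfl fun _ _ => Finset.sum_congr rfl fun _ _ => ?_
  ring

theorem discreteEnergy_add_smul_self (n : ℕ) (u v : C(S.K, ℝ)) (t : ℝ) :
    S.discreteEnergy n (u + t • v) (u + t • v) =
      S.discreteEnergy n u u + 2 * t * S.discreteEnergy n u v
        + t ^ 2 * S.discreteEnergy n v v := by
  rw [discreteEnergy_add_left, discreteEnergy_smul_left, discreteEnergy_comm n u (u + t • v),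
    discreteEnergy_comm n v (u + t • v), discreteEnergy_add_left, discreteEnergy_add_left,
    discreteEnergy_smul_left, discreteEnergy_smul_left, discreteEnergy_comm n v u]
  ring

theorem discreteEnergy_const_left (n : ℕ) (c : ℝ) (v : C(S.K, ℝ)) :
    S.discreteEnergy n (ContinuousMap.const S.K c) v = 0 := by
  simp [discreteEnergy]

theorem energy_comm (f g : S.F) : energy f g = energy g f :=
  tendsto_nhds_unique (tendsto_energy f g)
    ((tendsto_energy g f).congr fun n => discreteEnergy_comm n _ _)

theorem energy_self_nonneg (f : S.F) : 0 ≤ energy f f :=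
  (S.discreteEnergy_self_nonneg 0 f).trans (discreteEnergy_le_energy f 0)

theorem energy_add_left (f f' g : S.F) : energy (f + f') g = energy f g + energy f' g := by
  rw [energy_comm, energy_add_right, energy_comm g f, energy_comm g f']

theorem energy_smul_left (r : ℝ) (f g : S.F) : energy (r • f) g = r * energy f g := by
  rw [energy_comm, energy_smul_right, energy_comm g f]

theorem energy_add_sub_energy_sub (f g : S.F) :
    energy (f + g) (f + g) - energy (f - g) (f - g) = 4 * energy f g := by
  rw [show f - g = f + (-1 : ℝ) • g by module]
  simp only [energy_add_left, energy_add_right, energy_smul_left, energy_smul_right,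
    energy_comm g f]
  ring

/-! ### Restriction to cells and self-similarity of the energy -/

/-- The pull-back of a function of finite energy by the contraction `φ i`. -/
noncomputable def compPhi (f : S.F) (i : Fin 3) : S.F :=
  ⟨(f : C(S.K, ℝ)).comp (S.phi i), by
    obtain ⟨a, ha⟩ := f.2
    refine ⟨3 / 5 * a, ?_⟩
    rintro _ ⟨n, rfl⟩
    have h1 : S.discreteEnergy (n + 1) f f ≤ a := ha ⟨n + 1, rfl⟩
    rw [discreteEnergy_self_succ] at h1
    have h2 := Finset.single_le_sum (s := Finset.univ)
      (f := fun i => S.discreteEnergy n ((f : C(S.K, ℝ)).comp (S.phi i))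
        ((f : C(S.K, ℝ)).comp (S.phi i)))
      (fun j _ => S.discreteEnergy_self_nonneg n _) (Finset.mem_univ i)
    simp only at h2 ⊢
    linarith⟩

@[simp]
theorem compPhi_coe (f : S.F) (i : Fin 3) :
    (compPhi f i : C(S.K, ℝ)) = (f : C(S.K, ℝ)).comp (S.phi i) := rfl

theorem compPhi_apply (f : S.F) (i : Fin 3) (x : S.K) :
    (compPhi f i : C(S.K, ℝ)) x = (f : C(S.K, ℝ)) (S.phi i x) := rfl

theorem energy_self_eq_sum (f : S.F) :
    energy f f = 5 / 3 * ∑ i, energy (compPhi f i) (compPhi f i) := by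
  refine tendsto_nhds_unique ((tendsto_energy f f).comp (tendsto_add_atTop_nat 1))
    (((tendsto_finsetSum _ fun i _ => tendsto_energy (compPhi f i) (compPhi f i)).const_mul
      (5 / 3)).congr fun n => ?_)
  exact (discreteEnergy_self_succ S n _).symm

theorem energy_compPhi_le (f : S.F) (i : Fin 3) :
    energy (compPhi f i) (compPhi f i) ≤ 3 / 5 * energy f f := by
  have h2 := Finset.single_le_sum (s := Finset.univ)
    (f := fun i => energy (compPhi f i) (compPhi f i))
    (fun j _ => energy_self_nonneg _) (Finset.mem_univ i)
  rw [energy_self_eq_sum f]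
  linarith

theorem exists_eq_phi (x : S.K) : ∃ (i : Fin 3) (y : S.K), x = S.phi i y := by
  obtain ⟨i, y, hy, hxy⟩ := Set.mem_iUnion.mp (S.selfSimilar.subset x.2)
  exact ⟨i, ⟨y, hy⟩, Subtype.ext hxy.symm⟩

theorem exists_eq_wordMap (n : ℕ) (x : S.K) :
    ∃ (w : Fin n → Fin 3) (y : S.K), x = S.wordMap n w y := by
  induction n generalizing x with
  | zero => exact ⟨![], x, rfl⟩
  | succ n ih =>
    obtain ⟨i, y, rfl⟩ := exists_eq_phi x
    obtain ⟨w, z, rfl⟩ := ih y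
    exact ⟨Fin.cons i w, z, by simp [wordMap]⟩

theorem exists_forall_dist_wordMap_lt {δ : ℝ} (hδ : 0 < δ) :
    ∃ n, ∀ (w : Fin n → Fin 3) (x y : S.K),
      dist (S.wordMap n w x) (S.wordMap n w y) < δ := by
  have h := (tendsto_pow_atTop_nhds_zero_of_lt_one (r := (2⁻¹ : ℝ)) (by norm_num)
    (by norm_num)).mul_const (Metric.diam (Set.univ : Set S.K))
  rw [zero_mul] at h
  obtain ⟨n, hn⟩ := (h.eventually (gt_mem_nhds hδ)).exists
  refine ⟨n, fun w x y => ?_⟩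
  rw [dist_wordMap]
  refine lt_of_le_of_lt ?_ hn
  gcongr
  exact Metric.dist_le_diam_of_mem isCompact_univ.isBounded (Set.mem_univ _) (Set.mem_univ _)

theorem exists_forall_abs_sub_wordMap_lt (f : C(S.K, ℝ)) {ε : ℝ} (hε : 0 < ε) :
    ∃ n, ∀ (w : Fin n → Fin 3) (x y : S.K),
      |f (S.wordMap n w x) - f (S.wordMap n w y)| < ε := by
  obtain ⟨δ, hδ, h⟩ := Metric.uniformContinuous_iff.mp
    (CompactSpace.uniformContinuous_of_continuous f.continuous) ε hε
  obtain ⟨n, hn⟩ := exists_forall_dist_wordMap_lt (S := S) hδ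
  exact ⟨n, fun w x y => by rw [← Real.dist_eq]; exact h (hn w x y)⟩

/-! ### Oscillation bounded by the energy -/

theorem discreteEnergy_zero (u v : C(S.K, ℝ)) : S.discreteEnergy 0 u v =
    ∑ i, (u (S.vertex i) - u (S.vertex (i + 1))) * (v (S.vertex i) - v (S.vertex (i + 1))) := by
  simp [discreteEnergy, wordMap]

theorem sq_sub_le_energy (f : S.F) (i j : Fin 3) :
    ((f : C(S.K, ℝ)) (S.vertex i) - (f : C(S.K, ℝ)) (S.vertex j)) ^ 2 ≤ energy f f := by
  refine le_trans ?_ (discreteEnergy_le_energy f 0)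
  rw [discreteEnergy_zero, Fin.sum_univ_three]
  simp only [Fin.isValue, show (0 : Fin 3) + 1 = 1 from rfl, show (1 : Fin 3) + 1 = 2 from rfl,
    show (2 : Fin 3) + 1 = 0 from rfl]
  generalize ha : (f : C(S.K, ℝ)) (S.vertex 0) = a
  generalize hb : (f : C(S.K, ℝ)) (S.vertex 1) = b
  generalize hc : (f : C(S.K, ℝ)) (S.vertex 2) = c
  fin_cases i <;> fin_cases j <;> simp [ha, hb, hc] <;>
    nlinarith [sq_nonneg (a - b), sq_nonneg (b - c), sq_nonneg (c - a)]

/-- Chaining through cells: a point `φ_i y` is joined to `φ_i(p_0)` inside cell `i` by induction,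
and `φ_i(p_0) = φ_0(p_i)` to `p_0` inside cell `0` by the bound on vertices. The energy on a cell
shrinks by `3/5`, so the costs form a convergent geometric series; `ε` pays for the oscillation on
the last cells. -/
theorem abs_sub_vertex_le_of_wordMap (n : ℕ) (f : S.F) {ε : ℝ}
    (h : ∀ (w : Fin n → Fin 3) x y,
      |(f : C(S.K, ℝ)) (S.wordMap n w x) - (f : C(S.K, ℝ)) (S.wordMap n w y)| ≤ ε) (x : S.K) :
    |(f : C(S.K, ℝ)) x - (f : C(S.K, ℝ)) (S.vertex 0)| ≤ 4 * √(energy f f) + ε := by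
  induction n generalizing f x with
  | zero =>
    have := h ![] x (S.vertex 0)
    simp only [wordMap, ContinuousMap.id_apply] at this
    have := Real.sqrt_nonneg (energy f f)
    linarith
  | succ n ih =>
    obtain ⟨i, y, rfl⟩ := exists_eq_phi x
    have h1 := ih (compPhi f i) (fun w x y => by
      simpa [wordMap, Fin.tail_cons] using h (Fin.cons i w) x y) y
    -- `3/5 ≤ (4/5)^2`, and the constant `4` reproduces itself: `4 * (4/5) + 4/5 = 4`.
    have hq : ∀ j, √(energy (compPhi f j) (compPhi f j)) ≤ 4 / 5 * √(energy f f) := fun j => by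
      rw [Real.sqrt_le_iff]
      refine ⟨by positivity, ?_⟩
      rw [mul_pow, Real.sq_sqrt (energy_self_nonneg f)]
      have := energy_compPhi_le f j
      have := energy_self_nonneg f
      linarith
    have h2 := Real.abs_le_sqrt (sq_sub_le_energy (compPhi f 0) i 0)
    rw [compPhi_apply, compPhi_apply, phi_vertex_comm, phi_vertex_self] at h2
    rw [compPhi_apply, compPhi_apply] at h1
    have h3 := abs_sub_le ((f : C(S.K, ℝ)) (S.phi i y)) ((f : C(S.K, ℝ)) (S.phi i (S.vertex 0)))
      ((f : C(S.K, ℝ)) (S.vertex 0))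
    have := hq i
    have := hq 0
    linarith

theorem abs_sub_vertex_le (f : S.F) (x : S.K) :
    |(f : C(S.K, ℝ)) x - (f : C(S.K, ℝ)) (S.vertex 0)| ≤ 4 * √(energy f f) := by
  refine le_of_forall_pos_le_add fun ε hε => ?_
  obtain ⟨n, hn⟩ := exists_forall_abs_sub_wordMap_lt (f : C(S.K, ℝ)) hε
  exact abs_sub_vertex_le_of_wordMap n f (fun w x y => (hn w x y).le) x

/-! ### Harmonic functions: extension rule, minimum principle, existence, separation of points -/

/-- `E_n - E_0` is a nonnegative quadratic form vanishing at `u`, so `u` lies in the kernel of its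
bilinear form. -/
theorem IsHarmonic.discreteEnergy_eq {u : S.F} (hu : S.IsHarmonic u) (n : ℕ) (v : C(S.K, ℝ)) :
    S.discreteEnergy n u v = S.discreteEnergy 0 u v := by
  have key : ∀ t : ℝ, 0 ≤ 2 * t * (S.discreteEnergy n u v - S.discreteEnergy 0 u v) +
      t ^ 2 * (S.discreteEnergy n v v - S.discreteEnergy 0 v v) := fun t => by
    have h1 := S.discreteEnergy_self_mono ((u : C(S.K, ℝ)) + t • v) (Nat.zero_le n)
    have h2 := hu n
    simp only [discreteEnergy_add_smul_self] at h1
    linarith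
  have hc : 0 ≤ S.discreteEnergy n v v - S.discreteEnergy 0 v v :=
    sub_nonneg.mpr (S.discreteEnergy_self_mono v (Nat.zero_le n))
  rw [← sub_eq_zero]
  generalize S.discreteEnergy n u v - S.discreteEnergy 0 u v = b at key ⊢
  generalize S.discreteEnergy n v v - S.discreteEnergy 0 v v = c at key hc
  -- A nearly optimal `t`; the `+ 1` keeps the denominator positive when `c = 0`.
  have h := key (-b / (c + 1))
  have hc1 : 0 < c + 1 := by linarith
  have h' : 2 * (-b / (c + 1)) * b + (-b / (c + 1)) ^ 2 * c = -(b ^ 2 * (c + 2)) / (c + 1) ^ 2 := by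
    field_simp
    ring
  rw [h', le_div_iff₀ (by positivity), zero_mul] at h
  nlinarith [sq_nonneg b]

theorem IsHarmonic.energy_eq {u : S.F} (hu : S.IsHarmonic u) (v : S.F) :
    energy u v = S.discreteEnergy 0 u v :=
  tendsto_nhds_unique (tendsto_energy u v)
    (tendsto_const_nhds.congr fun n => (hu.discreteEnergy_eq n v).symm)

theorem IsHarmonic.add {u v : S.F} (hu : S.IsHarmonic u) (hv : S.IsHarmonic v) :
    S.IsHarmonic (u + v) := fun n => by
  have h1 := discreteEnergy_add_smul_self n (u : C(S.K, ℝ)) v 1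
  have h2 := discreteEnergy_add_smul_self 0 (u : C(S.K, ℝ)) v 1
  rw [one_smul] at h1 h2
  rw [Submodule.coe_add, h1, h2, hu n, hv n, hu.discreteEnergy_eq n]

theorem IsHarmonic.smul {u : S.F} (hu : S.IsHarmonic u) (c : ℝ) : S.IsHarmonic (c • u) := by
  intro n
  simp only [Submodule.coe_smul, discreteEnergy_smul_left, discreteEnergy_comm _ (u : C(S.K, ℝ)),
    hu n]

theorem isHarmonic_const (c : ℝ) :
    S.IsHarmonic ⟨ContinuousMap.const S.K c, const_mem c⟩ := fun n => by
  simp only [discreteEnergy_const_left]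

/-- Each cell satisfies `E_0 ≤ E_n`, and harmonicity of `u` forces the sums over the cells to agree,
so equality holds cell by cell. -/
theorem IsHarmonic.compPhi {u : S.F} (hu : S.IsHarmonic u) (i : Fin 3) :
    S.IsHarmonic (compPhi u i) := fun n => by
  have h1 := S.discreteEnergy_self_succ n u
  have h0 := S.discreteEnergy_self_succ 0 u
  rw [hu (n + 1), ← hu (0 + 1), h0] at h1
  have h2 : ∑ i, S.discreteEnergy 0 ((u : C(S.K, ℝ)).comp (S.phi i))
      ((u : C(S.K, ℝ)).comp (S.phi i)) = ∑ i, S.discreteEnergy n ((u : C(S.K, ℝ)).comp (S.phi i))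
      ((u : C(S.K, ℝ)).comp (S.phi i)) := by linarith
  exact ((Finset.sum_eq_sum_iff_of_le fun i _ =>
    S.discreteEnergy_self_mono _ (Nat.zero_le n)).mp h2 i (Finset.mem_univ i)).symm

/-- The "1/5-2/5" extension rule: `E_1 = E_0` says that the values at the three midpoints attain the
minimum of a strictly convex quadratic function. -/
theorem IsHarmonic.apply_phi_vertex {u : S.F} (hu : S.IsHarmonic u) {i j k : Fin 3}
    (hij : i ≠ j) (hjk : j ≠ k) (hki : k ≠ i) :
    (u : C(S.K, ℝ)) (S.phi i (S.vertex j)) = (2 * (u : C(S.K, ℝ)) (S.vertex i) +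
      2 * (u : C(S.K, ℝ)) (S.vertex j) + (u : C(S.K, ℝ)) (S.vertex k)) / 5 := by
  have h01 := S.phi_vertex_comm 0 1
  have h12 := S.phi_vertex_comm 1 2
  have h20 := S.phi_vertex_comm 2 0
  have h := hu (0 + 1)
  rw [discreteEnergy_self_succ] at h
  simp only [discreteEnergy_zero, ContinuousMap.comp_apply, Fin.sum_univ_three, Fin.isValue,
    show (0 : Fin 3) + 1 = 1 from rfl, show (1 : Fin 3) + 1 = 2 from rfl,
    show (2 : Fin 3) + 1 = 0 from rfl, phi_vertex_self, h01, h12, h20] at h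
  have key : ∀ a b c x y z : ℝ, 5 / 3 * ((a - x) * (a - x) + (x - z) * (x - z) +
      (z - a) * (z - a) + ((x - b) * (x - b) + (b - y) * (b - y) + (y - x) * (y - x)) +
      ((z - y) * (z - y) + (y - c) * (y - c) + (c - z) * (c - z))) =
      (a - b) * (a - b) + (b - c) * (b - c) + (c - a) * (c - a) →
      x = (2 * a + 2 * b + c) / 5 ∧ y = (2 * b + 2 * c + a) / 5 ∧ z = (2 * c + 2 * a + b) / 5 := by
    intro a b c x y z h
    -- Shifting by the minimizer leaves a positive definite form in `X, Y, Z`, which must vanish.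
    obtain ⟨X, rfl⟩ : ∃ X, x = X + (2 * a + 2 * b + c) / 5 := ⟨_, (sub_add_cancel _ _).symm⟩
    obtain ⟨Y, rfl⟩ : ∃ X, y = X + (2 * b + 2 * c + a) / 5 := ⟨_, (sub_add_cancel _ _).symm⟩
    obtain ⟨Z, rfl⟩ : ∃ X, z = X + (2 * c + 2 * a + b) / 5 := ⟨_, (sub_add_cancel _ _).symm⟩
    have h' : (X - Y) ^ 2 + (Y - Z) ^ 2 + (Z - X) ^ 2 + 2 * X ^ 2 + 2 * Y ^ 2 + 2 * Z ^ 2 = 0 := by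
      linear_combination 3 / 5 * h
    have h1 := sq_nonneg (X - Y)
    have h2 := sq_nonneg (Y - Z)
    have h3 := sq_nonneg (Z - X)
    have hX : X ^ 2 = 0 := by linarith [sq_nonneg X, sq_nonneg Y, sq_nonneg Z]
    have hY : Y ^ 2 = 0 := by linarith [sq_nonneg X, sq_nonneg Y, sq_nonneg Z]
    have hZ : Z ^ 2 = 0 := by linarith [sq_nonneg X, sq_nonneg Y, sq_nonneg Z]
    simp only [pow_eq_zero_iff two_ne_zero] at hX hY hZ
    simp [hX, hY, hZ]
  obtain ⟨hx, hy, hz⟩ := key _ _ _ _ _ _ h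
  rw [phi_vertex_comm] at hx hy hz
  have hsymm : ∀ i j, (u : C(S.K, ℝ)) (S.phi i (S.vertex j)) =
      (u : C(S.K, ℝ)) (S.phi j (S.vertex i)) := fun i j => by rw [phi_vertex_comm]
  generalize hg : (fun i j => (u : C(S.K, ℝ)) (S.phi i (S.vertex j))) = g
  generalize hb : (fun i => (u : C(S.K, ℝ)) (S.vertex i)) = b
  have hg' : ∀ i j, (u : C(S.K, ℝ)) (S.phi i (S.vertex j)) = g i j := fun i j => by rw [← hg]
  have hb' : ∀ i, (u : C(S.K, ℝ)) (S.vertex i) = b i := fun i => by rw [← hb]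
  simp only [hg', hb'] at hx hy hz hsymm ⊢
  clear h key h01 h12 h20 hg hb hg' hb' hu
  fin_cases i <;> fin_cases j <;> first
    | exact absurd rfl hij
    | fin_cases k <;> first
      | exact absurd rfl hki
      | exact absurd rfl hjk
      | (simp only [Fin.zero_eta, Fin.mk_one, Fin.reduceFinMk, Fin.isValue]
         linarith [hsymm 0 1, hsymm 1 2, hsymm 2 0])

theorem exists_third (i j : Fin 3) (hij : i ≠ j) : ∃ k, j ≠ k ∧ k ≠ i := by
  revert i j
  decide

theorem eq_third {i j k : Fin 3} (hij : i ≠ j) (hjk : j ≠ k) (hki : k ≠ i) (l : Fin 3) :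
    l = i ∨ l = j ∨ l = k := by
  revert i j k l
  decide

/-- By the extension rule the boundary values on subcells are convex combinations of the old ones,
so a lower bound passes to all points `φ_w(p_0)`; these are dense. -/
theorem IsHarmonic.le_apply {u : S.F} (hu : S.IsHarmonic u) {m : ℝ}
    (hm : ∀ i, m ≤ (u : C(S.K, ℝ)) (S.vertex i)) (x : S.K) : m ≤ (u : C(S.K, ℝ)) x := by
  have key : ∀ n (w : Fin n → Fin 3), m ≤ (u : C(S.K, ℝ)) (S.wordMap n w (S.vertex 0)) := by
    intro n
    induction n generalizing u with
    | zero => exact fun w => hm 0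
    | succ n ih =>
      intro w
      refine ih (hu.compPhi (w 0)) (fun j => ?_) (Fin.tail w)
      rw [compPhi_apply]
      by_cases hij : w 0 = j
      · rw [hij, phi_vertex_self]
        exact hm j
      · obtain ⟨k, hjk, hki⟩ := exists_third _ _ hij
        rw [hu.apply_phi_vertex hij hjk hki]
        linarith [hm (w 0), hm j, hm k]
  by_contra! hx
  obtain ⟨n, hn⟩ := exists_forall_abs_sub_wordMap_lt (u : C(S.K, ℝ)) (sub_pos.mpr hx)
  obtain ⟨w, y, rfl⟩ := exists_eq_wordMap n x
  have h1 := neg_lt_of_abs_lt (hn w y (S.vertex 0))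
  have h2 := key n w
  linarith

theorem IsHarmonic.apply_pos {u : S.F} (hu : S.IsHarmonic u)
    (hm : ∀ i, 0 < (u : C(S.K, ℝ)) (S.vertex i)) (x : S.K) : 0 < (u : C(S.K, ℝ)) x := by
  obtain ⟨i, hi⟩ := Finite.exists_min fun i => (u : C(S.K, ℝ)) (S.vertex i)
  exact (hm i).trans_le (hu.le_apply hi x)

theorem IsHarmonic.ext {u v : S.F} (hu : S.IsHarmonic u) (hv : S.IsHarmonic v)
    (h : ∀ i, (u : C(S.K, ℝ)) (S.vertex i) = (v : C(S.K, ℝ)) (S.vertex i)) : u = v := by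
  refine Subtype.ext (ContinuousMap.ext fun x => ?_)
  have h1 := (hu.add (hv.smul (-1))).le_apply (m := 0) (fun i => by simp [h i]) x
  have h2 := (hv.add (hu.smul (-1))).le_apply (m := 0) (fun i => by simp [h i]) x
  simp at h1 h2
  linarith

/-- On the cells `j ≠ i` all boundary values are positive, so a zero lies in cell `i`, where the
pull-back satisfies the same hypotheses. Iterating confines the zero to `φ_i^n(K)`, which shrinks to
the vertex. -/
theorem IsHarmonic.eq_vertex {u : S.F} (hu : S.IsHarmonic u) {i : Fin 3}
    (hi : (u : C(S.K, ℝ)) (S.vertex i) = 0)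
    (hpos : ∀ j, i ≠ j → 0 < (u : C(S.K, ℝ)) (S.vertex j)) {x : S.K}
    (hx : (u : C(S.K, ℝ)) x = 0) : x = S.vertex i := by
  have key : ∀ n : ℕ, ∃ y, dist x (S.vertex i) = 2⁻¹ ^ n * dist y (S.vertex i) := by
    intro n
    induction n generalizing u x with
    | zero => exact ⟨x, by simp⟩
    | succ n ih =>
      obtain ⟨j, y, rfl⟩ := exists_eq_phi x
      have hij : i = j := by
        by_contra hij
        refine ((hu.compPhi j).apply_pos (fun k => ?_) y).ne' hx
        rw [compPhi_apply]
        by_cases hjk : j = k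
        · rw [hjk, phi_vertex_self]
          exact hpos k (hjk ▸ hij)
        · obtain ⟨l, hkl, hlj⟩ := exists_third _ _ hjk
          rw [hu.apply_phi_vertex hjk hkl hlj]
          have hnn : ∀ m, 0 ≤ (u : C(S.K, ℝ)) (S.vertex m) := fun m => by
            by_cases him : i = m
            · rw [← him, hi]
            · exact (hpos m him).le
          linarith [hpos j hij, hnn k, hnn l]
      subst hij
      obtain ⟨z, hz⟩ := ih (hu.compPhi i) (by rw [compPhi_apply, phi_vertex_self, hi])
        (fun j hij => by
          obtain ⟨k, hjk, hki⟩ := exists_third _ _ hij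
          rw [compPhi_apply, hu.apply_phi_vertex hij hjk hki]
          linarith [hpos j hij, hpos k hki.symm]) hx
      refine ⟨z, ?_⟩
      rw [← S.phi_vertex_self i, dist_phi, hz, S.phi_vertex_self i]
      ring
  rw [← dist_le_zero]
  have h := (tendsto_pow_atTop_nhds_zero_of_lt_one (r := (2⁻¹ : ℝ)) (by norm_num)
    (by norm_num)).mul_const (Metric.diam (Set.univ : Set S.K))
  rw [zero_mul] at h
  refine ge_of_tendsto' h fun n => ?_
  obtain ⟨y, hy⟩ := key n
  rw [hy]
  gcongr
  exact Metric.dist_le_diam_of_mem isCompact_univ.isBounded (Set.mem_univ _) (Set.mem_univ _)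

theorem exists_affine_combination_eq (b₀ b₁ : Fin 3 → ℝ)
    (h : ∀ r s t : ℝ, (∀ i, r * b₀ i + s * b₁ i + t = 0) → r = 0 ∧ s = 0 ∧ t = 0)
    (b : Fin 3 → ℝ) : ∃ r s t : ℝ, ∀ i, r * b₀ i + s * b₁ i + t = b i := by
  let T : (Fin 3 → ℝ) →ₗ[ℝ] (Fin 3 → ℝ) :=
    { toFun := fun a i => a 0 * b₀ i + a 1 * b₁ i + a 2
      map_add' := fun a a' => by
        ext i
        simp only [Pi.add_apply]
        ring
      map_smul' := fun c a => by
        ext i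
        simp only [Pi.smul_apply, smul_eq_mul, RingHom.id_apply]
        ring }
  have hT : Function.Injective T := by
    rw [← LinearMap.ker_eq_bot, LinearMap.ker_eq_bot']
    intro a ha
    obtain ⟨h0, h1, h2⟩ := h _ _ _ fun i => congrFun ha i
    ext i
    fin_cases i
    · exact h0
    · exact h1
    · exact h2
  obtain ⟨a, ha⟩ := LinearMap.injective_iff_surjective.mp hT b
  exact ⟨a 0, a 1, a 2, fun i => congrFun ha i⟩

/-- The boundary values of `h 0`, `h 1` and `1` form a basis of `ℝ^3`: a relation makes `r h_0 + s
h_1` constant on the vertices, hence of energy zero by harmonicity, while orthonormality gives it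
energy `r^2 + s^2`. -/
theorem exists_isHarmonic (ψ : S.HarmonicSystem) (b : Fin 3 → ℝ) :
    ∃ u : S.F, S.IsHarmonic u ∧ ∀ i, (u : C(S.K, ℝ)) (S.vertex i) = b i := by
  have hind : ∀ r s t : ℝ, (∀ i, r * (ψ.h 0 : C(S.K, ℝ)) (S.vertex i) +
      s * (ψ.h 1 : C(S.K, ℝ)) (S.vertex i) + t = 0) → r = 0 ∧ s = 0 ∧ t = 0 := by
    intro r s t h
    have huh : S.IsHarmonic (r • ψ.h 0 + s • ψ.h 1) :=
      ((ψ.harmonic 0).smul _).add ((ψ.harmonic 1).smul _)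
    have h0 : energy (r • ψ.h 0 + s • ψ.h 1) (r • ψ.h 0 + s • ψ.h 1) = 0 := by
      rw [huh.energy_eq, discreteEnergy_zero]
      refine Finset.sum_eq_zero fun i _ => ?_
      have h' : ∀ i, ((r • ψ.h 0 + s • ψ.h 1 : S.F) : C(S.K, ℝ)) (S.vertex i) = -t := fun i =>
        eq_neg_of_add_eq_zero_left (h i)
      rw [h', h', sub_self, mul_zero]
    have h1 : energy (r • ψ.h 0 + s • ψ.h 1) (r • ψ.h 0 + s • ψ.h 1) = r * r + s * s := by
      rw [energy_add_left, energy_add_right, energy_add_right, energy_smul_left, energy_smul_left,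
        energy_smul_left, energy_smul_left, energy_smul_right, energy_smul_right,
        energy_smul_right, energy_smul_right]
      simp only [ψ.orthonormal]
      simp
    rw [h1] at h0
    obtain ⟨hr, hs⟩ := mul_self_add_mul_self_eq_zero.mp h0
    have := h 0
    rw [hr, hs] at this
    exact ⟨hr, hs, by linarith⟩
  obtain ⟨r, s, t, h⟩ := exists_affine_combination_eq _ _ hind b
  have ht : S.IsHarmonic ⟨ContinuousMap.const S.K t, const_mem t⟩ := isHarmonic_const t
  have hu := (((ψ.harmonic 0).smul r).add ((ψ.harmonic 1).smul s)).add ht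
  exact ⟨_, hu, h⟩

/-- The harmonic extension matrices are invertible. This is what transports `ν`-null sets, and
separation of points, from `K` to its cells. -/
theorem IsHarmonic.exists_compPhi_eq (ψ : S.HarmonicSystem) {v : S.F} (hv : S.IsHarmonic v)
    (i : Fin 3) : ∃ u : S.F, S.IsHarmonic u ∧ SierpinskiGasket.compPhi u i = v := by
  obtain ⟨j, hij⟩ : ∃ j, i ≠ j := ⟨i + 1, by revert i; decide⟩
  obtain ⟨k, hjk, hki⟩ := exists_third _ _ hij
  -- These boundary values solve the extension rule backwards for `u` in terms of `v`.
  obtain ⟨u, hu, hb⟩ := exists_isHarmonic ψ fun l => if l = i then (v : C(S.K, ℝ)) (S.vertex i)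
    else if l = j then (10 * (v : C(S.K, ℝ)) (S.vertex j) - 5 * (v : C(S.K, ℝ)) (S.vertex k) -
      2 * (v : C(S.K, ℝ)) (S.vertex i)) / 3
    else (10 * (v : C(S.K, ℝ)) (S.vertex k) - 5 * (v : C(S.K, ℝ)) (S.vertex j) -
      2 * (v : C(S.K, ℝ)) (S.vertex i)) / 3
  have hi := hb i
  have hj := hb j
  have hk := hb k
  rw [if_pos rfl] at hi
  rw [if_neg hij.symm, if_pos rfl] at hj
  rw [if_neg hki, if_neg hjk.symm] at hk
  refine ⟨u, hu, (hu.compPhi i).ext hv fun l => ?_⟩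
  rw [compPhi_apply]
  rcases eq_third hij hjk hki l with rfl | rfl | rfl
  · rw [phi_vertex_self, hi]
  · rw [hu.apply_phi_vertex hij hjk hki, hi, hj, hk]
    ring
  · rw [hu.apply_phi_vertex hki.symm hjk.symm hij.symm, hi, hj, hk]
    ring

/-- Points in a common cell are rescaled, which doubles their distance; since `K` is bounded, this
cannot go on forever for distinct points. Points in different cells `i`, `j` are handled by a
harmonic function that is nonnegative on cell `i`, nonpositive on cell `j`, and vanishes there only
at the common point of the two cells. -/
theorem eq_of_forall_isHarmonic (ψ : S.HarmonicSystem) {x y : S.K}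
    (h : ∀ u : S.F, S.IsHarmonic u → (u : C(S.K, ℝ)) x = (u : C(S.K, ℝ)) y) : x = y := by
  have key : ∀ n : ℕ, ∃ x' y' : S.K, dist x y = 2⁻¹ ^ n * dist x' y' := by
    intro n
    induction n generalizing x y with
    | zero => exact ⟨x, y, by simp⟩
    | succ n ih =>
      obtain ⟨i, x, rfl⟩ := exists_eq_phi x
      obtain ⟨j, y, rfl⟩ := exists_eq_phi y
      by_cases hij : i = j
      · subst hij
        obtain ⟨x', y', h'⟩ := ih (x := x) (y := y) fun v hv => by
          obtain ⟨u, hu, rfl⟩ := hv.exists_compPhi_eq ψ i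
          exact h u hu
        refine ⟨x', y', ?_⟩
        rw [dist_phi, h']
        ring
      · obtain ⟨k, hjk, hki⟩ := exists_third _ _ hij
        -- With boundary values `1, -1, 0` at `i, j, k`, the extension rule gives `u = 0` at
        -- `φ_i(p_j)` and values `1`, `1/5` at the other corners of cell `i`; cell `j` is the mirror
        -- image with opposite sign.
        obtain ⟨u, hu, hb⟩ := exists_isHarmonic ψ fun l => if l = i then 1 else
          if l = j then -1 else 0
        have hbi := hb i
        have hbj := hb j
        have hbk := hb k
        rw [if_pos rfl] at hbi
        rw [if_neg (Ne.symm hij), if_pos rfl] at hbj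
        rw [if_neg hki, if_neg hjk.symm] at hbk
        have hu1 := hu.compPhi i
        have hu2 := (hu.smul (-1)).compPhi j
        have c1 : (compPhi u i : C(S.K, ℝ)) (S.vertex j) = 0 := by
          rw [compPhi_apply, hu.apply_phi_vertex hij hjk hki, hbi, hbj, hbk]; norm_num
        have c2 : ∀ l, j ≠ l → 0 < (compPhi u i : C(S.K, ℝ)) (S.vertex l) := by
          intro l hl
          rcases eq_third hij hjk hki l with rfl | rfl | rfl
          · rw [compPhi_apply, phi_vertex_self, hbi]; norm_num
          · exact absurd rfl hl
          · rw [compPhi_apply, hu.apply_phi_vertex hki.symm hjk.symm (Ne.symm hij), hbi, hbj, hbk]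
            norm_num
        have d1 : (compPhi ((-1 : ℝ) • u) j : C(S.K, ℝ)) (S.vertex i) = 0 := by
          rw [compPhi_apply, (hu.smul (-1)).apply_phi_vertex (Ne.symm hij) hki.symm hjk.symm]
          simp [hbi, hbj, hbk]
        have d2 : ∀ l, i ≠ l → 0 < (compPhi ((-1 : ℝ) • u) j : C(S.K, ℝ)) (S.vertex l) := by
          intro l hl
          rcases eq_third hij hjk hki l with rfl | rfl | rfl
          · exact absurd rfl hl
          · rw [compPhi_apply, phi_vertex_self]; simp [hbj]
          · rw [compPhi_apply, (hu.smul (-1)).apply_phi_vertex hjk hki hij]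
            simp [hbi, hbj, hbk]
        have e1 := hu1.le_apply (m := 0) (fun l => by
          by_cases hl : j = l
          · rw [← hl, c1]
          · exact (c2 l hl).le) x
        have e2 := hu2.le_apply (m := 0) (fun l => by
          by_cases hl : i = l
          · rw [← hl, d1]
          · exact (d2 l hl).le) y
        have e3 := h u hu
        have e4 : (compPhi ((-1 : ℝ) • u) j : C(S.K, ℝ)) y =
          - (u : C(S.K, ℝ)) (S.phi j y) := by simp
        rw [e4] at e2
        rw [compPhi_apply] at e1
        have f1 : (u : C(S.K, ℝ)) (S.phi i x) = 0 := by linarith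
        have f2 : (u : C(S.K, ℝ)) (S.phi j y) = 0 := by linarith
        rw [hu1.eq_vertex c1 c2 (x := x) f1,
          hu2.eq_vertex d1 d2 (x := y) (by rw [e4, f2, neg_zero]), phi_vertex_comm]
        exact ⟨x, x, by simp⟩
  rw [← dist_le_zero]
  have h := (tendsto_pow_atTop_nhds_zero_of_lt_one (r := (2⁻¹ : ℝ)) (by norm_num)
    (by norm_num)).mul_const (Metric.diam (Set.univ : Set S.K))
  rw [zero_mul] at h
  refine ge_of_tendsto' h fun n => ?_
  obtain ⟨x', y', hy⟩ := key n
  rw [hy]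
  gcongr
  exact Metric.dist_le_diam_of_mem isCompact_univ.isBounded (Set.mem_univ _) (Set.mem_univ _)

/-! ### Density of `F_ℂ` in `C(K, ℂ)` and in `L_2` -/

theorem mul_mem_F {u v : C(S.K, ℝ)} (hu : u ∈ S.F) (hv : v ∈ S.F) : u * v ∈ S.F := by
  obtain ⟨a, ha⟩ := hu
  obtain ⟨b, hb⟩ := hv
  refine ⟨2 * ‖v‖ ^ 2 * a + 2 * ‖u‖ ^ 2 * b, ?_⟩
  rintro _ ⟨n, rfl⟩
  have h1 : S.discreteEnergy n u u ≤ a := ha ⟨n, rfl⟩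
  have h2 : S.discreteEnergy n v v ≤ b := hb ⟨n, rfl⟩
  have h3 : S.discreteEnergy n (u * v) (u * v) ≤
      2 * ‖v‖ ^ 2 * S.discreteEnergy n u u + 2 * ‖u‖ ^ 2 * S.discreteEnergy n v v := by
    simp only [discreteEnergy, Finset.mul_sum, ← Finset.sum_add_distrib]
    refine Finset.sum_le_sum fun w _ => Finset.sum_le_sum fun i _ => ?_
    generalize S.wordMap n w (S.vertex i) = x
    generalize S.wordMap n w (S.vertex (i + 1)) = y
    have hx : u x ^ 2 ≤ ‖u‖ ^ 2 := sq_le_sq' (abs_le.mp (u.norm_coe_le_norm x)).1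
      (abs_le.mp (u.norm_coe_le_norm x)).2
    have hy : v y ^ 2 ≤ ‖v‖ ^ 2 := sq_le_sq' (abs_le.mp (v.norm_coe_le_norm y)).1
      (abs_le.mp (v.norm_coe_le_norm y)).2
    have h4 := mul_le_mul_of_nonneg_right hx (sq_nonneg (v x - v y))
    have h5 := mul_le_mul_of_nonneg_right hy (sq_nonneg (u x - u y))
    -- Leibniz: the increment of `u v` is `u x (v x - v y) + v y (u x - u y)`, and `(a + b)^2 ≤ 2
    -- a^2 + 2 b^2`.
    have h6 := sq_nonneg (u x * (v x - v y) - v y * (u x - u y))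
    have h7 : (u x * v x - u y * v y) * (u x * v x - u y * v y) ≤
        2 * ‖v‖ ^ 2 * ((u x - u y) * (u x - u y)) + 2 * ‖u‖ ^ 2 * ((v x - v y) * (v x - v y)) := by
      linarith
    have h8 := mul_le_mul_of_nonneg_left h7 (by positivity : (0 : ℝ) ≤ (5 / 3) ^ n)
    simp only [ContinuousMap.mul_apply]
    linarith
  refine h3.trans ?_
  gcongr

variable (S) in
/-- The functions in `F_ℂ` form a star subalgebra of `C(K, ℂ)`. -/
noncomputable def starSubalgebraFC : StarSubalgebra ℂ C(S.K, ℂ) where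
  carrier := S.FC
  add_mem' := S.FC.add_mem
  mul_mem' {u v} hu hv := by
    refine ⟨?_, ?_⟩
    · convert S.F.sub_mem (mul_mem_F hu.1 hv.1) (mul_mem_F hu.2 hv.2) using 1
      ext x
      simp
    · convert S.F.add_mem (mul_mem_F hu.1 hv.2) (mul_mem_F hu.2 hv.1) using 1
      ext x
      simp
  algebraMap_mem' c := by
    rw [Algebra.algebraMap_eq_smul_one]
    exact S.FC.smul_mem c one_mem_FC
  star_mem' {u} hu := by
    refine ⟨?_, ?_⟩
    · convert hu.1 using 1
      ext x
      simp
    · convert S.F.neg_mem hu.2 using 1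
      ext x
      simp

theorem dense_FC (ψ : S.HarmonicSystem) : Dense (S.FC : Set C(S.K, ℂ)) := by
  have hsep : (starSubalgebraFC S).SeparatesPoints := by
    intro x y hxy
    by_contra! h
    refine hxy (eq_of_forall_isHarmonic ψ fun u _ => ?_)
    have hu : Complex.ofRealCLM.compLeftContinuous ℝ S.K (u : C(S.K, ℝ)) ∈ S.FC := by
      refine ⟨?_, ?_⟩
      · convert u.2 using 1
        ext x
        simp
      · convert S.F.zero_mem using 1
        ext x
        simp
    have := h _ ⟨_, hu, rfl⟩
    simpa using this
  have h := ContinuousMap.starSubalgebra_topologicalClosure_eq_top_of_separatesPoints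
    (starSubalgebraFC S) hsep
  rw [dense_iff_closure_eq]
  have h' := congrArg (fun A : StarSubalgebra ℂ C(S.K, ℂ) => (A : Set C(S.K, ℂ))) h
  rw [StarSubalgebra.topologicalClosure_coe] at h'
  exact h'

theorem denseRange_toL2 (ψ : S.HarmonicSystem) : DenseRange (toL2 ψ) := by
  have h1 : DenseRange (ContinuousMap.toLp 2 (kusuokaMeasure ψ) ℂ : C(S.K, ℂ) → L2 ψ) :=
    ContinuousMap.toLp_denseRange ℂ (kusuokaMeasure ψ) ℂ (by norm_num)
  have h2 : DenseRange (Subtype.val : S.FC → C(S.K, ℂ)) := (dense_FC ψ).denseRange_val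
  exact h1.comp h2 (ContinuousMap.toLp 2 (kusuokaMeasure ψ) ℂ).continuous

theorem eq_zero_of_forall_inner_toL2 (ψ : S.HarmonicSystem) {w : L2 ψ}
    (h : ∀ u : S.FC, inner ℂ (toL2 ψ u) w = 0) : w = 0 := by
  exact (denseRange_toL2 ψ).eq_zero_of_inner_right ℂ h

/-! ### Energy measures and their absolute continuity -/

theorem measure_ext_of_integral_eq {μ μ' : Measure S.K} [IsFiniteMeasure μ] [IsFiniteMeasure μ']
    (h : ∀ g : C(S.K, ℝ), ∫ x, g x ∂μ = ∫ x, g x ∂μ') : μ = μ' :=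
  ext_of_forall_integral_eq_of_IsFiniteMeasure fun g => h g.toContinuousMap

theorem integrable_continuousMap (μ : Measure S.K) [IsFiniteMeasure μ] (g : C(S.K, ℝ)) :
    Integrable g μ :=
  (BoundedContinuousFunction.mkOfCompact g).integrable μ

theorem energyMeasure_real_univ (f : S.F) : (energyMeasure f).real Set.univ = energy f f := by
  refine tendsto_nhds_unique ?_ (tendsto_energy f f)
  have h := (isEnergyMeasure_energyMeasure f).2 1
  simp only [discreteEnergyIntegral_one] at h
  simpa using h

theorem energyMeasure_add_add_sub (f g : S.F) :
    energyMeasure (f + g) + energyMeasure (f - g) =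
      (2 : NNReal) • energyMeasure f + (2 : NNReal) • energyMeasure g := by
  refine measure_ext_of_integral_eq fun u => ?_
  rw [integral_add_measure (integrable_continuousMap _ _) (integrable_continuousMap _ _),
    integral_add_measure (integrable_continuousMap _ _) (integrable_continuousMap _ _),
    integral_smul_nnreal_measure, integral_smul_nnreal_measure]
  refine tendsto_nhds_unique (((isEnergyMeasure_energyMeasure (f + g)).2 u).add
    ((isEnergyMeasure_energyMeasure (f - g)).2 u))
    (((((isEnergyMeasure_energyMeasure f).2 u).const_mul 2).add
    (((isEnergyMeasure_energyMeasure g).2 u).const_mul 2)).congr fun n => ?_)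
  simp only [discreteEnergyIntegral, Finset.mul_sum, ← Finset.sum_add_distrib, Submodule.coe_add,
    Submodule.coe_sub, ContinuousMap.add_apply, ContinuousMap.sub_apply]
  refine Finset.sum_congr rfl fun _ _ => Finset.sum_congr rfl fun _ _ => ?_
  ring

theorem energyMeasure_smul (c : ℝ) (f : S.F) :
    energyMeasure (c • f) = (c ^ 2).toNNReal • energyMeasure f := by
  refine measure_ext_of_integral_eq fun u => ?_
  rw [integral_smul_nnreal_measure, NNReal.smul_def, Real.coe_toNNReal _ (sq_nonneg c)]
  refine tendsto_nhds_unique ((isEnergyMeasure_energyMeasure (c • f)).2 u)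
    ((((isEnergyMeasure_energyMeasure f).2 u).const_mul (c ^ 2)).congr fun n => ?_)
  simp only [discreteEnergyIntegral, Finset.mul_sum, Submodule.coe_smul,
    ContinuousMap.smul_apply, smul_eq_mul]
  refine Finset.sum_congr rfl fun _ _ => Finset.sum_congr rfl fun _ _ => ?_
  ring

theorem energyMeasure_const (c : ℝ) :
    energyMeasure (⟨ContinuousMap.const S.K c, const_mem c⟩ : S.F) = 0 := by
  refine measure_ext_of_integral_eq fun u => ?_
  rw [integral_zero_measure]
  refine tendsto_nhds_unique ((isEnergyMeasure_energyMeasure _).2 u)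
    (tendsto_const_nhds.congr fun n => ?_)
  simp [discreteEnergyIntegral]

theorem energyMeasure_eq_sum_map (f : S.F) : energyMeasure f =
    (5 / 3 : NNReal) • ∑ i, (energyMeasure (compPhi f i)).map (S.phi i) := by
  have hfin : ∀ i, IsFiniteMeasure ((energyMeasure (compPhi f i)).map (S.phi i)) := fun i =>
    Measure.isFiniteMeasure_map _ _
  have hfin' : IsFiniteMeasure (∑ i, (energyMeasure (compPhi f i)).map (S.phi i)) := by
    refine ⟨?_⟩
    rw [Measure.finsetSum_apply]
    exact ENNReal.sum_lt_top.mpr fun k _ => measure_lt_top _ _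
  refine measure_ext_of_integral_eq fun u => ?_
  rw [integral_smul_nnreal_measure, integral_finsetSum_measure fun i _ =>
    integrable_continuousMap _ _]
  refine tendsto_nhds_unique (((isEnergyMeasure_energyMeasure f).2 u).comp
    (tendsto_add_atTop_nat 1)) ?_
  have h : ∀ i, ∫ x, u x ∂((energyMeasure (compPhi f i)).map (S.phi i)) =
      ∫ x, u.comp (S.phi i) x ∂(energyMeasure (compPhi f i)) := fun i => by
    rw [integral_map (S.phi i).continuous.aemeasurable u.continuous.aestronglyMeasurable]
    rfl
  simp only [h]
  rw [NNReal.smul_def, smul_eq_mul]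
  push_cast
  refine ((tendsto_finsetSum _ fun i _ =>
    (isEnergyMeasure_energyMeasure (compPhi f i)).2 (u.comp (S.phi i))).const_mul
      (5 / 3)).congr fun n => ?_
  exact (discreteEnergyIntegral_succ S n _ _).symm

/-- The parallelogram law for energy measures, with the term of `f - g` dropped. -/
theorem energyMeasure_add_le (f g : S.F) (A : Set S.K) : (energyMeasure (f + g)).real A ≤
    2 * (energyMeasure f).real A + 2 * (energyMeasure g).real A := by
  have h : (_ : Measure S.K).real A = (_ : Measure S.K).real A :=
    congrArg (fun μ : Measure S.K => μ.real A) (energyMeasure_add_add_sub f g)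
  rw [measureReal_add_apply, measureReal_add_apply, measureReal_nnreal_smul_apply,
    measureReal_nnreal_smul_apply] at h
  have := measureReal_nonneg (μ := energyMeasure (f - g)) (s := A)
  push_cast at h
  linarith

theorem energyMeasure_real_eq_sum (f : S.F) {A : Set S.K} (hA : MeasurableSet A) :
    (energyMeasure f).real A =
      5 / 3 * ∑ i, (energyMeasure (compPhi f i)).real (S.phi i ⁻¹' A) := by
  have h : (_ : Measure S.K).real A = (_ : Measure S.K).real A :=
    congrArg (fun μ : Measure S.K => μ.real A) (energyMeasure_eq_sum_map f)
  rw [measureReal_nnreal_smul_apply, measureReal_def (μ := ∑ _, _), Measure.finsetSum_apply] at h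
  simp only [Measure.map_apply (S.phi _).continuous.measurable hA] at h
  rw [ENNReal.toReal_sum fun i _ => measure_ne_top _ _] at h
  exact h

theorem kusuokaMeasure_real_eq_zero (ψ : S.HarmonicSystem) {A : Set S.K}
    (h : (kusuokaMeasure ψ).real A = 0) (i : Fin 2) : (energyMeasure (ψ.h i)).real A = 0 := by
  rw [kusuokaMeasure, measureReal_add_apply] at h
  have h0 := measureReal_nonneg (μ := energyMeasure (ψ.h 0)) (s := A)
  have h1 := measureReal_nonneg (μ := energyMeasure (ψ.h 1)) (s := A)
  fin_cases i
  · exact (add_eq_zero_iff_of_nonneg h0 h1).mp h |>.1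
  · exact (add_eq_zero_iff_of_nonneg h0 h1).mp h |>.2

theorem IsHarmonic.energyMeasure_real_eq_zero (ψ : S.HarmonicSystem) {u : S.F}
    (hu : S.IsHarmonic u) {A : Set S.K} (h : (kusuokaMeasure ψ).real A = 0) :
    (energyMeasure u).real A = 0 := by
  obtain ⟨a, c, rfl⟩ := ψ.complete u hu
  refine le_antisymm ((energyMeasure_add_le _ _ A).trans ?_) measureReal_nonneg
  rw [energyMeasure_const, Fin.sum_univ_two]
  have h1 := energyMeasure_add_le (a 0 • ψ.h 0) (a 1 • ψ.h 1) A
  rw [energyMeasure_smul, energyMeasure_smul, measureReal_nnreal_smul_apply,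
    measureReal_nnreal_smul_apply, kusuokaMeasure_real_eq_zero ψ h,
    kusuokaMeasure_real_eq_zero ψ h] at h1
  simp only [measureReal_zero_apply]
  linarith

/-- Each `h k` is the pull-back by `φ_i` of a harmonic `u`, and `ν_u(A) = 0`. By self-similarity
`ν_u(A)` is a positive multiple of a sum of nonnegative terms, one of which is `ν_{h k}(φ_i⁻¹ A)`.
-/
theorem kusuokaMeasure_real_preimage_phi (ψ : S.HarmonicSystem) {A : Set S.K}
    (hA : MeasurableSet A) (h : (kusuokaMeasure ψ).real A = 0) (i : Fin 3) :
    (kusuokaMeasure ψ).real (S.phi i ⁻¹' A) = 0 := by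
  have key : ∀ k, (energyMeasure (ψ.h k)).real (S.phi i ⁻¹' A) = 0 := fun k => by
    obtain ⟨u, hu, hk⟩ := (ψ.harmonic k).exists_compPhi_eq ψ i
    have h1 := hu.energyMeasure_real_eq_zero ψ h
    rw [energyMeasure_real_eq_sum u hA] at h1
    have h2 : ∑ i, (energyMeasure (SierpinskiGasket.compPhi u i)).real (S.phi i ⁻¹' A) = 0 := by
      linarith
    rw [Finset.sum_eq_zero_iff_of_nonneg fun _ _ => measureReal_nonneg] at h2
    rw [← hk]
    exact h2 i (Finset.mem_univ i)
  rw [kusuokaMeasure, measureReal_add_apply, key, key, add_zero]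

/-- For `n = 0`, `f` is split into its harmonic part, whose energy measure does not charge `A`, and
an orthogonal remainder of energy `E(f, f) - E_0(f, f)`, which bounds the mass of its energy
measure. Self-similarity carries the bound from level `n` on the cells to level `n + 1`, with `A`
replaced by the null sets `φ_i⁻¹ A`. -/
theorem energyMeasure_real_le (ψ : S.HarmonicSystem) (n : ℕ) (f : S.F) {A : Set S.K}
    (hA : MeasurableSet A) (h : (kusuokaMeasure ψ).real A = 0) :
    (energyMeasure f).real A ≤ 2 * (energy f f - S.discreteEnergy n f f) := by
  induction n generalizing f A with
  | zero =>
    obtain ⟨u, hu, hb⟩ := exists_isHarmonic ψ fun i => (f : C(S.K, ℝ)) (S.vertex i)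
    obtain ⟨g, rfl⟩ : ∃ g, f = u + g := ⟨f - u, by abel⟩
    have hg : ∀ i, (g : C(S.K, ℝ)) (S.vertex i) = 0 := fun i => by simpa using hb i
    have h0 : S.discreteEnergy 0 (u : C(S.K, ℝ)) g = 0 := by simp [discreteEnergy_zero, hg]
    have h1 : S.discreteEnergy 0 (g : C(S.K, ℝ)) g = 0 := by simp [discreteEnergy_zero, hg]
    have h2 : energy u g = 0 := by rw [hu.energy_eq, h0]
    have h3 := energyMeasure_add_le u g A
    have h4 : (energyMeasure g).real A ≤ energy g g := by
      rw [← energyMeasure_real_univ]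
      exact measureReal_mono (Set.subset_univ A)
    have h5 : energy (u + g) (u + g) = energy u u + energy g g := by
      rw [energy_add_left, energy_add_right, energy_add_right, energy_comm g u, h2]
      ring
    have h6 := discreteEnergy_add_smul_self 0 (u : C(S.K, ℝ)) g 1
    rw [one_smul, h0, h1] at h6
    rw [hu.energyMeasure_real_eq_zero ψ h] at h3
    rw [h5, Submodule.coe_add, h6, ← hu.energy_eq]
    linarith
  | succ n ih =>
    rw [energyMeasure_real_eq_sum f hA, energy_self_eq_sum, discreteEnergy_self_succ]
    have h1 := Finset.sum_le_sum fun (i : Fin 3) (_ : i ∈ Finset.univ) =>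
      ih (compPhi f i) (hA.preimage (S.phi i).continuous.measurable)
        (kusuokaMeasure_real_preimage_phi ψ hA h i)
    rw [← Finset.mul_sum, Finset.sum_sub_distrib] at h1
    simp only [compPhi_coe] at h1
    linarith

/-- Energy measures are absolutely continuous with respect to the Kusuoka measure. -/
theorem energyMeasure_absolutelyContinuous (ψ : S.HarmonicSystem) (f : S.F) :
    energyMeasure f ≪ kusuokaMeasure ψ := by
  refine Measure.AbsolutelyContinuous.mk fun A hA h => ?_
  have h' : (kusuokaMeasure ψ).real A = 0 := by rw [measureReal_def, h, ENNReal.toReal_zero]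
  rw [← measureReal_eq_zero_iff]
  refine le_antisymm ?_ measureReal_nonneg
  refine ge_of_tendsto' (x := atTop) ?_ fun n => energyMeasure_real_le ψ n f hA h'
  simpa using (((tendsto_energy f f).const_sub (energy f f)).const_mul 2)

/-! ### The derivation as an isometry for the energy -/

/-- Absolute continuity enters here: without it the density would only see part of the mass `E(f,
f)`. -/
theorem integral_gammaSelf (ψ : S.HarmonicSystem) (f : S.F) :
    ∫ x, gammaSelf ψ f x ∂(kusuokaMeasure ψ) = energy f f := by
  rw [← energyMeasure_real_univ]
  exact Measure.integral_toReal_rnDeriv (energyMeasure_absolutelyContinuous ψ f)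

theorem integral_gamma (ψ : S.HarmonicSystem) (f g : S.F) :
    ∫ x, gamma ψ f g x ∂(kusuokaMeasure ψ) = energy f g := by
  simp only [gamma, gammaSelf]
  rw [integral_div, integral_sub Measure.integrable_toReal_rnDeriv
    Measure.integrable_toReal_rnDeriv]
  change (∫ x, gammaSelf ψ (f + g) x ∂_ - ∫ x, gammaSelf ψ (f - g) x ∂_) / 4 = _
  rw [integral_gammaSelf, integral_gammaSelf, energy_add_sub_energy_sub]
  ring

theorem integral_gammaC (ψ : S.HarmonicSystem) (f g : S.FC) :
    ∫ x, gammaC ψ f g x ∂(kusuokaMeasure ψ) = energyC f g := by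
  have hi := fun u v => (gamma_integrable ψ u v).ofReal (𝕜 := ℂ)
  have h := fun u v : S.F => integral_ofReal (μ := kusuokaMeasure ψ) (𝕜 := ℂ) (f := gamma ψ u v)
  simp only [integral_gamma] at h
  simp only [gammaC, energyC]
  rw [integral_add, integral_add, integral_sub, integral_const_mul, integral_const_mul]
  · exact congrArg₂ _ (congrArg₂ _ (congrArg₂ _ (h _ _) (congrArg _ (h _ _)))
      (congrArg _ (h _ _))) (h _ _)
  · exact hi _ _
  · exact (hi _ _).const_mul _
  · exact (hi _ _).sub ((hi _ _).const_mul _)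
  · exact (hi _ _).const_mul _
  · exact ((hi _ _).sub ((hi _ _).const_mul _)).add ((hi _ _).const_mul _)
  · exact hi _ _

theorem inner_derivation (ψ : S.HarmonicSystem) (f g : S.FC) :
    inner ℂ (derivation ψ g) (derivation ψ f) = energyC f g := by
  have h : inner ℂ (derivation ψ g) (derivation ψ f) =
      form ψ (g ⊗ₜ ⟨1, one_mem_FC⟩) (f ⊗ₜ ⟨1, one_mem_FC⟩) :=
    UniformSpace.Completion.inner_coe (𝕜 := ℂ) (E := PreForm ψ) _ _
  rw [h, form_tmul, ← integral_gammaC ψ]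
  simp

/-! ### Full support of the Kusuoka measure -/

/-- A nonempty open set contains a cell `φ_w(K)`. Were it null, pulling back along `φ_w` would make
all of `K` null, although `ν_{h 0}` has mass `E(h_0, h_0) = 1`. -/
theorem kusuokaMeasure_isOpenPosMeasure (ψ : S.HarmonicSystem) :
    (kusuokaMeasure ψ).IsOpenPosMeasure := by
  refine ⟨fun U hU ⟨x, hx⟩ h0 => ?_⟩
  have key : ∀ n (w : Fin n → Fin 3) (A : Set S.K), MeasurableSet A →
      (kusuokaMeasure ψ).real A = 0 → (kusuokaMeasure ψ).real (S.wordMap n w ⁻¹' A) = 0 := by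
    intro n
    induction n with
    | zero => exact fun w A _ hA => hA
    | succ n ih =>
      exact fun w A hm hA => ih (Fin.tail w) _ (hm.preimage (S.phi (w 0)).continuous.measurable)
          (kusuokaMeasure_real_preimage_phi ψ hm hA (w 0))
  obtain ⟨δ, hδ, hball⟩ := Metric.isOpen_iff.mp hU x hx
  obtain ⟨n, hn⟩ := exists_forall_dist_wordMap_lt (S := S) hδ
  obtain ⟨w, y, rfl⟩ := exists_eq_wordMap n x
  have h1 := key n w U hU.measurableSet (by rw [measureReal_def, h0, ENNReal.toReal_zero])
  have h2 : S.wordMap n w ⁻¹' U = Set.univ :=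
    Set.eq_univ_of_forall fun z => hball (hn w z y)
  rw [h2] at h1
  have h3 := kusuokaMeasure_real_eq_zero ψ h1 0
  rw [energyMeasure_real_univ, ψ.orthonormal] at h3
  simp at h3

theorem toL2_injective (ψ : S.HarmonicSystem) : Function.Injective (toL2 ψ) := by
  have := kusuokaMeasure_isOpenPosMeasure ψ
  intro f g h
  exact Subtype.ext (ContinuousMap.toLp_injective (kusuokaMeasure ψ) h)

/-! ### Completeness modulo constants and closed range of the derivation -/

theorem energy_const_left (c : ℝ) (v : S.F) :
    energy (⟨ContinuousMap.const S.K c, const_mem c⟩ : S.F) v = 0 :=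
  tendsto_nhds_unique (tendsto_energy _ v)
    (tendsto_const_nhds.congr fun n => (discreteEnergy_const_left n c _).symm)

theorem energy_self_sub_const (u : S.F) (c : ℝ) :
    energy (u - ⟨ContinuousMap.const S.K c, const_mem c⟩)
      (u - ⟨ContinuousMap.const S.K c, const_mem c⟩) = energy u u := by
  have h : ∀ v : S.F, energy (u - ⟨ContinuousMap.const S.K c, const_mem c⟩) v = energy u v := by
    intro v
    have h1 := energy_add_left (u - ⟨ContinuousMap.const S.K c, const_mem c⟩)
      ⟨ContinuousMap.const S.K c, const_mem c⟩ v
    rw [sub_add_cancel, energy_const_left, add_zero] at h1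
    exact h1.symm
  rw [h, energy_comm, h]

theorem continuous_discreteEnergy_self (n : ℕ) :
    Continuous fun u : C(S.K, ℝ) => S.discreteEnergy n u u := by
  simp only [discreteEnergy]
  have h : ∀ x : S.K, Continuous fun u : C(S.K, ℝ) => u x := continuous_eval_const
  exact continuous_const.mul (continuous_finsetSum _ fun w _ => continuous_finsetSum _ fun i _ =>
    ((h _).sub (h _)).mul ((h _).sub (h _)))

theorem norm_le_of_apply_vertex_eq_zero {u : S.F} (hu : (u : C(S.K, ℝ)) (S.vertex 0) = 0) :
    ‖(u : C(S.K, ℝ))‖ ≤ 4 * √(energy u u) :=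
  (ContinuousMap.norm_le _ (by positivity)).mpr fun x => by
    simpa [hu] using abs_sub_vertex_le u x

/-- The normalization at a vertex turns the oscillation bound into a bound on the sup norm, so an
energy-Cauchy sequence converges uniformly. Each `E_l` is continuous for uniform convergence, which
gives bounds on `E_l(f_m - g)` uniform in `l`. -/
theorem exists_energy_limit_of_apply_vertex_eq_zero (f : ℕ → S.F)
    (h0 : ∀ n, (f n : C(S.K, ℝ)) (S.vertex 0) = 0)
    (hf : ∀ ε > 0, ∃ N, ∀ m ≥ N, ∀ n ≥ N, energy (f m - f n) (f m - f n) < ε) :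
    ∃ g : S.F, ∀ ε > 0, ∃ N, ∀ n ≥ N, energy (f n - g) (f n - g) ≤ ε := by
  have hc : CauchySeq fun n => (f n : C(S.K, ℝ)) := by
    refine Metric.cauchySeq_iff.mpr fun ε hε => ?_
    obtain ⟨N, hN⟩ := hf ((ε / 4) ^ 2) (by positivity)
    refine ⟨N, fun m hm n hn => ?_⟩
    have h1 := norm_le_of_apply_vertex_eq_zero (u := f m - f n) (by simp [h0])
    have h2 := Real.sqrt_lt_sqrt (energy_self_nonneg _) (hN m hm n hn)
    rw [Real.sqrt_sq (by positivity)] at h2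
    rw [dist_eq_norm]
    rw [Submodule.coe_sub] at h1
    linarith
  obtain ⟨g, hg⟩ := cauchySeq_tendsto_of_complete hc
  have key : ∀ ε > 0, ∃ N, ∀ m ≥ N, ∀ l,
      S.discreteEnergy l ((f m : C(S.K, ℝ)) - g) ((f m : C(S.K, ℝ)) - g) ≤ ε := by
    intro ε hε
    obtain ⟨N, hN⟩ := hf ε hε
    refine ⟨N, fun m hm l => ?_⟩
    refine le_of_tendsto (((continuous_discreteEnergy_self l).tendsto _).comp (hg.const_sub _))
      (eventually_atTop.mpr ⟨N, fun n hn => ?_⟩)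
    exact (discreteEnergy_le_energy (f m - f n) l).trans (hN m hm n hn).le
  have hgF : g ∈ S.F := by
    obtain ⟨N, hN⟩ := key 1 one_pos
    have h1 : (f N : C(S.K, ℝ)) - g ∈ S.F := by
      refine ⟨1, ?_⟩
      rintro _ ⟨l, rfl⟩
      exact hN N le_rfl l
    simpa using S.F.sub_mem (f N).2 h1
  refine ⟨⟨g, hgF⟩, fun ε hε => ?_⟩
  obtain ⟨N, hN⟩ := key ε hε
  exact ⟨N, fun n hn => le_of_tendsto' (tendsto_energy _ _) (hN n hn)⟩

/-- The space `F` modulo constants is complete with respect to the energy. -/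
theorem exists_energy_limit (f : ℕ → S.F)
    (hf : ∀ ε > 0, ∃ N, ∀ m ≥ N, ∀ n ≥ N, energy (f m - f n) (f m - f n) < ε) :
    ∃ g : S.F, ∀ ε > 0, ∃ N, ∀ n ≥ N, energy (f n - g) (f n - g) ≤ ε := by
  let c : ℝ → S.F := fun r => ⟨ContinuousMap.const S.K r, const_mem r⟩
  let a : ℕ → ℝ := fun n => (f n : C(S.K, ℝ)) (S.vertex 0)
  obtain ⟨g, hg⟩ := exists_energy_limit_of_apply_vertex_eq_zero (fun n => f n - c (a n))
    (fun n => by simp [c, a]) fun ε hε => by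
      obtain ⟨N, hN⟩ := hf ε hε
      refine ⟨N, fun m hm n hn => ?_⟩
      have h : f m - c (a m) - (f n - c (a n)) = f m - f n - c (a m - a n) := by
        ext x
        simp [c]
        ring
      rw [h, energy_self_sub_const]
      exact hN m hm n hn
  refine ⟨g, fun ε hε => ?_⟩
  obtain ⟨N, hN⟩ := hg ε hε
  refine ⟨N, fun n hn => ?_⟩
  have h := hN n hn
  rwa [sub_right_comm, energy_self_sub_const] at h

theorem norm_derivation_sq (ψ : S.HarmonicSystem) (f : S.FC) :
    ‖derivation ψ f‖ ^ 2 =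
      energy (rePart f) (rePart f) + energy (imPart f) (imPart f) := by
  rw [← inner_self_eq_norm_sq (𝕜 := ℂ), inner_derivation, energyC, energy_comm (imPart f)]
  simp

theorem rePart_sub (u v : S.FC) : rePart (u - v) = rePart u - rePart v := by
  ext x; simp [rePart]

theorem imPart_sub (u v : S.FC) : imPart (u - v) = imPart u - imPart v := by
  ext x; simp [imPart]

theorem exists_rePart_imPart_eq (g h : S.F) : ∃ u : S.FC, rePart u = g ∧ imPart u = h := by
  have hre : Complex.reCLM.compLeftContinuous ℝ S.K
      (Complex.ofRealCLM.compLeftContinuous ℝ S.K (g : C(S.K, ℝ)) +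
        Complex.I • Complex.ofRealCLM.compLeftContinuous ℝ S.K (h : C(S.K, ℝ))) = g := by
    ext x
    simp
  have him : Complex.imCLM.compLeftContinuous ℝ S.K
      (Complex.ofRealCLM.compLeftContinuous ℝ S.K (g : C(S.K, ℝ)) +
        Complex.I • Complex.ofRealCLM.compLeftContinuous ℝ S.K (h : C(S.K, ℝ))) = h := by
    ext x
    simp
  exact ⟨⟨_, by rw [hre]; exact g.2, by rw [him]; exact h.2⟩, Subtype.ext hre, Subtype.ext him⟩

/-- `‖∂f‖^2` is the sum of the energies of the real and imaginary parts, so a convergent sequence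
`∂f_n` gives two energy-Cauchy sequences in `F`, whose limits are recombined. -/
theorem isClosed_range_derivation (ψ : S.HarmonicSystem) :
    IsClosed (LinearMap.range (derivation ψ) : Set (OneForm ψ)) := by
  refine IsSeqClosed.isClosed fun v x hv hx => ?_
  choose f hf using hv
  have hc := Metric.cauchySeq_iff.mp hx.cauchySeq
  have key : ∀ ε > 0, ∃ N, ∀ m ≥ N, ∀ n ≥ N,
      energy (rePart (f m) - rePart (f n)) (rePart (f m) - rePart (f n)) +
      energy (imPart (f m) - imPart (f n)) (imPart (f m) - imPart (f n)) < ε := by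
    intro ε hε
    obtain ⟨N, hN⟩ := hc (√ε) (Real.sqrt_pos.mpr hε)
    refine ⟨N, fun m hm n hn => ?_⟩
    have h := hN m hm n hn
    rw [← hf, ← hf, dist_eq_norm, ← map_sub, Real.lt_sqrt (norm_nonneg _), norm_derivation_sq,
      rePart_sub, imPart_sub] at h
    exact h
  obtain ⟨g, hg⟩ := exists_energy_limit (fun n => rePart (f n)) fun ε hε => by
    obtain ⟨N, hN⟩ := key ε hε
    refine ⟨N, fun m hm n hn => lt_of_le_of_lt ?_ (hN m hm n hn)⟩
    exact le_add_of_nonneg_right (energy_self_nonneg _)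
  obtain ⟨h, hh⟩ := exists_energy_limit (fun n => imPart (f n)) fun ε hε => by
    obtain ⟨N, hN⟩ := key ε hε
    refine ⟨N, fun m hm n hn => lt_of_le_of_lt ?_ (hN m hm n hn)⟩
    exact le_add_of_nonneg_left (energy_self_nonneg _)
  obtain ⟨u, rfl, rfl⟩ := exists_rePart_imPart_eq g h
  refine ⟨u, tendsto_nhds_unique (Metric.tendsto_atTop.mpr fun ε hε => ?_) hx⟩
  obtain ⟨N₁, hN₁⟩ := hg (ε ^ 2 / 4) (by positivity)
  obtain ⟨N₂, hN₂⟩ := hh (ε ^ 2 / 4) (by positivity)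
  refine ⟨max N₁ N₂, fun n hn => ?_⟩
  have h1 := hN₁ n (le_of_max_le_left hn)
  have h2 := hN₂ n (le_of_max_le_right hn)
  rw [← hf, dist_eq_norm, ← map_sub]
  refine lt_of_pow_lt_pow_left₀ 2 hε.le ?_
  rw [norm_derivation_sq, rePart_sub, imPart_sub]
  have : 0 < ε ^ 2 := by positivity
  linarith

/-! ### The graphs of `∂*` and `Δ_ν`, and the orthogonal decomposition -/

theorem energyC_conj (f g : S.FC) : conj (energyC f g) = energyC g f := by
  simp only [energyC, energy_comm (rePart g), energy_comm (imPart g)]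
  apply Complex.ext <;> simp
  ring

theorem mem_divergenceGraph_iff (ψ : S.HarmonicSystem) (v : OneForm ψ) (w : L2 ψ) :
    (v, w) ∈ divergenceGraph ψ ↔
      ∀ u : S.FC, inner ℂ (toL2 ψ u) w = -inner ℂ (derivation ψ u) v := Iff.rfl

/-- The graph defines the operator faithfully only if it is single-valued; this is where density of
`F_ℂ` in `L_2` is used. -/
theorem mem_divergenceGraph_iff_exists (ψ : S.HarmonicSystem) (v : OneForm ψ) (w : L2 ψ) :
    (v, w) ∈ divergenceGraph ψ ↔ ∃ hv : v ∈ (divergence ψ).domain, divergence ψ ⟨v, hv⟩ = w := by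
  have h : ∀ q ∈ divergenceGraph ψ, q.1 = 0 → q.2 = 0 := fun q hq h0 =>
    eq_zero_of_forall_inner_toL2 ψ fun u => by rw [hq u, h0, inner_zero_right, neg_zero]
  rw [← Submodule.toLinearPMap_graph_eq _ h, LinearPMap.mem_graph_iff]
  constructor
  · rintro ⟨y, rfl, hy⟩
    exact ⟨y.2, hy⟩
  · rintro ⟨hv, hw⟩
    exact ⟨⟨v, hv⟩, rfl, hw⟩

/-- Since `E(f, g) = ⟨∂f, ∂g⟩`, the two defining equations are conjugates of each other. Injectivity
of `toL2` identifies the representative chosen in the graph of `Δ_ν` with `g`. -/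
theorem mem_laplacianGraph_iff (ψ : S.HarmonicSystem) (g : S.FC) (w : L2 ψ) :
    (toL2 ψ g, w) ∈ laplacianGraph ψ ↔ (derivation ψ g, w) ∈ divergenceGraph ψ := by
  have key : (∀ f : S.FC, energyC f g = -inner ℂ w (toL2 ψ f)) ↔
      (derivation ψ g, w) ∈ divergenceGraph ψ := by
    rw [mem_divergenceGraph_iff]
    refine forall_congr' fun u => ?_
    rw [inner_derivation, ← inner_conj_symm, ← energyC_conj, ← map_neg,
      (starRingEnd ℂ).injective.eq_iff, eq_neg_iff_add_eq_zero, eq_neg_iff_add_eq_zero, add_comm]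
  rw [← key]
  constructor
  · rintro ⟨g', hg', h⟩
    rwa [toL2_injective ψ hg'] at h
  · exact fun h => ⟨g, rfl, h⟩

theorem mem_laplacianGraph_iff_exists (ψ : S.HarmonicSystem) (v w : L2 ψ) :
    (v, w) ∈ laplacianGraph ψ ↔ ∃ hv : v ∈ (laplacian ψ).domain, laplacian ψ ⟨v, hv⟩ = w := by
  have h : ∀ q ∈ laplacianGraph ψ, q.1 = 0 → q.2 = 0 := by
    rintro ⟨v, w⟩ hq (rfl : v = 0)
    rw [← map_zero (toL2 ψ), mem_laplacianGraph_iff, mem_divergenceGraph_iff] at hq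
    exact eq_zero_of_forall_inner_toL2 ψ fun u => by
      rw [hq u, map_zero, inner_zero_right, neg_zero]
  rw [← Submodule.toLinearPMap_graph_eq _ h, LinearPMap.mem_graph_iff]
  constructor
  · rintro ⟨y, rfl, hy⟩
    exact ⟨y.2, hy⟩
  · rintro ⟨hv, hw⟩
    exact ⟨⟨v, hv⟩, rfl, hw⟩

theorem mem_kerDivergence_iff (ψ : S.HarmonicSystem) (w : OneForm ψ) :
    w ∈ kerDivergence ψ ↔ (w, 0) ∈ divergenceGraph ψ :=
  (mem_divergenceGraph_iff_exists ψ w 0).symm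

/-- Projection onto the closed range of `∂`; orthogonality to that range is the equation `∂*w = 0`.
-/
theorem exists_eq_derivation_add (ψ : S.HarmonicSystem) (v : OneForm ψ) :
    ∃ f : S.FC, ∃ w ∈ kerDivergence ψ, v = derivation ψ f + w := by
  have : CompleteSpace (LinearMap.range (derivation ψ)) :=
    (isClosed_range_derivation ψ).completeSpace_coe
  obtain ⟨_, ⟨f, rfl⟩, w, hw, rfl⟩ :=
    (LinearMap.range (derivation ψ)).exists_add_mem_mem_orthogonal v
  refine ⟨f, w, ?_, rfl⟩
  rw [mem_kerDivergence_iff, mem_divergenceGraph_iff]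
  intro u
  rw [inner_zero_right, (Submodule.mem_orthogonal _ _).mp hw _ ⟨u, rfl⟩, neg_zero]

end SierpinskiGasket

open SierpinskiGasket
theorem mainTheorem7 (S : SierpinskiGasket) (ψ : S.HarmonicSystem) :
    ((divergence ψ).domain : Set (OneForm ψ)) =
      {v | ∃ f : S.FC, toL2 ψ f ∈ (laplacian ψ).domain ∧
        ∃ w ∈ kerDivergence ψ, v = derivation ψ f + w} ∧
    (∀ (f : S.FC) (hf : toL2 ψ f ∈ (laplacian ψ).domain), ∀ w ∈ kerDivergence ψ,
      ∃ hv : derivation ψ f + w ∈ (divergence ψ).domain,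
        divergence ψ ⟨derivation ψ f + w, hv⟩ = laplacian ψ ⟨toL2 ψ f, hf⟩) ∧
    (∀ (g : S.FC) (hg : toL2 ψ g ∈ (laplacian ψ).domain),
      ∃ hv : derivation ψ g ∈ (divergence ψ).domain,
        laplacian ψ ⟨toL2 ψ g, hg⟩ = divergence ψ ⟨derivation ψ g, hv⟩) := by
  have h2 : ∀ (f : S.FC) (hf : toL2 ψ f ∈ (laplacian ψ).domain), ∀ w ∈ kerDivergence ψ,
      ∃ hv : derivation ψ f + w ∈ (divergence ψ).domain,
        divergence ψ ⟨derivation ψ f + w, hv⟩ = laplacian ψ ⟨toL2 ψ f, hf⟩ := by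
    intro f hf w hw
    have h := (mem_laplacianGraph_iff_exists ψ _ _).mpr ⟨hf, rfl⟩
    rw [mem_laplacianGraph_iff] at h
    rw [← mem_divergenceGraph_iff_exists]
    have := (divergenceGraph ψ).add_mem h ((mem_kerDivergence_iff ψ w).mp hw)
    rwa [Prod.mk_add_mk, add_zero] at this
  refine ⟨Set.ext fun v => ⟨fun hv => ?_, ?_⟩, h2, fun g hg => ?_⟩
  · obtain ⟨f, w, hw, rfl⟩ := exists_eq_derivation_add ψ v
    -- The decomposition only provides `f ∈ F_ℂ`. Subtracting `(w, 0)` within the graph of `∂*`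
    -- leaves `∂f` in `dom ∂*`, which places `f` in `dom Δ_ν`.
    have h := (divergenceGraph ψ).sub_mem ((mem_divergenceGraph_iff_exists ψ _ _).mpr ⟨hv, rfl⟩)
      ((mem_kerDivergence_iff ψ w).mp hw)
    rw [Prod.mk_sub_mk, add_sub_cancel_right, ← mem_laplacianGraph_iff,
      mem_laplacianGraph_iff_exists] at h
    exact ⟨f, h.1, w, hw, rfl⟩
  · rintro ⟨f, hf, w, hw, rfl⟩
    exact (h2 f hf w hw).1
  · have h := (mem_laplacianGraph_iff_exists ψ _ _).mpr ⟨hg, rfl⟩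
    rw [mem_laplacianGraph_iff, mem_divergenceGraph_iff_exists] at h
    exact ⟨h.1, h.2.symm⟩
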